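/- Let $\mathbb H$ be the quaternions, $\mathbb B=\{q\in\mathbb H:\ |q|<1\}$, $I\in\mathbb H$ with $I^2=-1$, and $\mathbb B_I=\mathbb B\cap(\mathbb R+I\mathbb R)$ with Lebesgue measure $d\lambda_I(u+Iv)=du\,dv$. Let $\alpha>-1$ and $\beta,\eta>0$, and put $\omega_{\beta,\eta}(t)=t^{\beta-1}(1-t)^{\eta-1}$ for $0<t<1$. For $p,q\in\mathbb B$ let $$K_{\beta,\eta}(p,q)=\frac{\Gamma(\beta+\eta)}{\pi\,\Gamma(\eta)\Gamma(\beta)}\sum_{k=0}^\infty\frac{(1)_k(\eta+\beta)_k}{(\beta)_k}\,\frac{p^k\,\overline q^{\,k}}{k!},\qquad (a)_k=a(a+1)\cdots(a+k-1).$$ For $x,y>0$ and complex $z$ with $0<|z|<1$ let $$R^\alpha_z(x,y)=\frac{1}{(1-z)\,(\sqrt{zxy})^{\alpha}}\exp\left(-\frac{z(x+y)}{1-z}\right)I_\alpha\left(\frac{2\sqrt{zxy}}{1-z}\right),\qquad I_\alpha(\xi)=\sum_{n=0}^\infty\frac{1}{n!\,\Gamma(\alpha+n+1)}\Big(\frac{\xi}{2}\Big)^{2n+\alpha},$$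 with principal branches, and $R^\alpha_0(x,y)=1/\Gamma(\alpha+1)$ (the limit as $z\to0$). This function is real for real $z$; it is extended to $q=u+Jv\in\mathbb B$ ($u,v\in\mathbb R$, $v\ge 0$, $J^2=-1$) by $R^\alpha_q(x,y)=\operatorname{Re}R^\alpha_{u+iv}(x,y)+J\,\operatorname{Im}R^\alpha_{u+iv}(x,y)$. Then for every $q\in\mathbb B$, every $I$ with $I^2=-1$ and all $x,y\in(0,\infty)$, $$R^\alpha_q(x,y)=\int_{\mathbb B_I}\overline{K_{\beta,\eta}(p,q)}\;R^\alpha_p(x,y)\;\omega_{\beta,\eta}(|p|^2)\,d\lambda_I(p),$$ and for every $q\in\mathbb B$ and $y\in(0,\infty)$, $$R^\alpha_{|q|^2}(y,y)=\int_0^\infty|R^\alpha_q(x,y)|^2\,x^\alpha e^{-x}\,dx,$$ both integrals being absolutely convergent. -/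

import Mathlib

open MeasureTheory
open scoped Quaternion ComplexConjugate

noncomputable section

/-- The modified Bessel function
`I_α(ξ) = ∑ₙ (ξ / 2) ^ (2 n + α) / (n! Γ(α + n + 1))` (principal branch of the power). -/
def besselI (α : ℝ) (ξ : ℂ) : ℂ :=
  ∑' n : ℕ, (1 / ((n.factorial : ℂ) * (Real.Gamma (α + n + 1) : ℂ))) *
    (ξ / 2) ^ ((2 * n + α : ℝ) : ℂ)

/-- The Hille-Hardy kernel in a complex variable `z`, `|z| < 1`:
`(1 - z)⁻¹ (√(z x y))^(-α) exp (- z (x + y) / (1 - z)) I_α (2 √(z x y) / (1 - z))`,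
with its removable singularity at `z = 0` filled by the limit `1 / Γ(α + 1)`. -/
def hilleHardyComplex (α x y : ℝ) (z : ℂ) : ℂ :=
  if z = 0 then ((Real.Gamma (α + 1))⁻¹ : ℝ)
  else
    1 / ((1 - z) * ((z * x * y) ^ (1 / 2 : ℂ)) ^ (α : ℂ)) *
      Complex.exp (-(z * (x + y)) / (1 - z)) *
      besselI α (2 * (z * x * y) ^ (1 / 2 : ℂ) / (1 - z))

/-- The point `u + I v` of the slice `ℝ + I ℝ` that corresponds to `z = u + i v`. -/
def slicePoint (I : ℍ) (z : ℂ) : ℍ := (z.re : ℍ) + z.im • I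

/-- The extension of a complex function `F` to quaternions, slice by slice: for
`q = u + I v` with `v = |Im q| ≥ 0` and `I = Im q / |Im q|`, the value is
`Re F(u + i v) + I Im F(u + i v)`. (For real `q` only the real part of `F(q)` is kept; the
functions `F` extended here are real on the real axis.) -/
def sliceExtension (F : ℂ → ℂ) (q : ℍ) : ℍ :=
  slicePoint (‖q.im‖⁻¹ • q.im) (F ⟨q.re, ‖q.im‖⟩)

/-- The Hille-Hardy kernel `R_q^α(x, y)` for a quaternion `q`. -/
def hilleHardyKernel (α : ℝ) (q : ℍ) (x y : ℝ) : ℍ :=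
  sliceExtension (hilleHardyComplex α x y) q

/-- The star-regularized Gauss hypergeometric series
`₂F₁*(a, b; c | [p, q]) = ∑ₖ ((a)ₖ (b)ₖ / (c)ₖ) pᵏ qᵏ / k!`. -/
def gaussStar (a b c : ℝ) (p q : ℍ) : ℍ :=
  ∑' k : ℕ, ((ascPochhammer ℝ k).eval a * (ascPochhammer ℝ k).eval b /
    (ascPochhammer ℝ k).eval c / (k.factorial : ℝ)) • (p ^ k * q ^ k)

/-- The Bergman kernel `K_{β,η}(p, q)`. -/
def bergmanKernel (β η : ℝ) (p q : ℍ) : ℍ :=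
  (Real.Gamma (β + η) / (Real.pi * Real.Gamma η * Real.Gamma β)) •
    gaussStar 1 (η + β) β p (star q)

/-- The weight `ω_{β,η}(t) = t ^ (β - 1) (1 - t) ^ (η - 1)` on `(0, 1)`. -/
def bergmanWeight (β η t : ℝ) : ℝ := t ^ (β - 1) * (1 - t) ^ (η - 1)

/-! The facts below confirm that the branches chosen above are immaterial: on the unit disc
the complex kernel is the given single-valued function, real on the real axis, so that its
slice-by-slice extension is consistent on every slice. -/

theorem hilleHardyComplex_eq (α : ℝ) {x y : ℝ} (hx : 0 < x) (hy : 0 < y) {z : ℂ}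
    (hz : ‖z‖ < 1) :
    hilleHardyComplex α x y z =
      (1 - z) ^ (-((α + 1 : ℝ) : ℂ)) * Complex.exp (-(z * (x + y)) / (1 - z)) *
        ∑' n : ℕ, (1 / ((n.factorial : ℂ) * (Real.Gamma (α + n + 1) : ℂ))) *
          (z * x * y / (1 - z) ^ 2) ^ n := by
  have hre : 0 < (1 - z).re := by
    have := Complex.re_le_norm z
    simp only [Complex.sub_re, Complex.one_re]; linarith
  have h1z : (1 - z) ≠ 0 := by
    intro h; rw [h] at hre; simp at hre
  have h1arg : |(1 - z).arg| < Real.pi / 2 := Complex.abs_arg_lt_pi_div_two_iff.2 (Or.inl hre)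
  by_cases h0 : z = 0
  · subst h0
    rw [hilleHardyComplex, if_pos rfl, tsum_eq_single 0]
    · simp
    · intro n hn; simp [hn]
  · rw [hilleHardyComplex, if_neg h0]
    have hxy : 0 < x * y := mul_pos hx hy
    set w : ℂ := z * x * y with hw
    have hw' : w = ((x * y : ℝ) : ℂ) * z := by rw [hw]; push_cast; ring
    have hw0 : w ≠ 0 := by
      rw [hw']; exact mul_ne_zero (by exact_mod_cast hxy.ne') h0
    set s : ℂ := w ^ (1 / 2 : ℂ) with hs
    have hs2 : s ^ 2 = w := by
      rw [hs, ← Complex.cpow_nat_mul]; simp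
    have hs0 : s ≠ 0 := by
      intro h; rw [h] at hs2; exact hw0 (by rw [← hs2]; simp)
    have hlogs : Complex.log s = Complex.log w / 2 := by
      have h1 := Complex.neg_pi_lt_arg w
      have h2 := Complex.arg_le_pi w
      have him : (Complex.log w * (1 / 2 : ℂ)).im = w.arg / 2 := by
        rw [mul_one_div, Complex.div_ofNat_im, Complex.log_im]
      rw [hs, Complex.cpow_def_of_ne_zero hw0, Complex.log_exp]
      · ring
      · rw [him]; linarith [Real.pi_pos]
      · rw [him]; linarith [Real.pi_pos]
    have hsarg : s.arg = w.arg / 2 := by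
      rw [← Complex.log_im, hlogs, Complex.div_ofNat_im, Complex.log_im]
    have hinvarg : (1 - z)⁻¹.arg = -(1 - z).arg := by
      rw [Complex.arg_inv, if_neg]
      intro h; rw [h, abs_of_pos Real.pi_pos] at h1arg; linarith [Real.pi_pos]
    have hlog : Complex.log (s * (1 - z)⁻¹) = Complex.log s - Complex.log (1 - z) := by
      rw [Complex.log_mul hs0 (inv_ne_zero h1z), Complex.log_inv]
      · ring
      · intro h; rw [h, abs_of_pos Real.pi_pos] at h1arg; linarith [Real.pi_pos]
      · rw [hsarg, hinvarg]
        have h1 := Complex.neg_pi_lt_arg w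
        have h2 := Complex.arg_le_pi w
        have h3 := abs_lt.1 h1arg
        constructor <;> linarith [h3.1, h3.2]
    have hv0 : s * (1 - z)⁻¹ ≠ 0 := mul_ne_zero hs0 (inv_ne_zero h1z)
    have hpow : (s * (1 - z)⁻¹) ^ (α : ℂ) = s ^ (α : ℂ) * (1 - z) ^ (-(α : ℂ)) := by
      rw [Complex.cpow_def_of_ne_zero hv0, hlog, Complex.cpow_def_of_ne_zero hs0,
        Complex.cpow_def_of_ne_zero h1z, ← Complex.exp_add]
      congr 1; ring
    have hterm : ∀ n : ℕ, (2 * s / (1 - z) / 2) ^ ((2 * n + α : ℝ) : ℂ) =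
        (w / (1 - z) ^ 2) ^ n * (s ^ (α : ℂ) * (1 - z) ^ (-(α : ℂ))) := by
      intro n
      have h : 2 * s / (1 - z) / 2 = s * (1 - z)⁻¹ := by field_simp
      have h2 : ((2 * n + α : ℝ) : ℂ) = ((2 * n : ℕ) : ℂ) + (α : ℂ) := by push_cast; ring
      rw [h, h2, Complex.cpow_add _ _ hv0, Complex.cpow_natCast, hpow, pow_mul, mul_pow, hs2,
        inv_pow, div_eq_mul_inv]
    have hneg : (1 - z) ^ (-((α + 1 : ℝ) : ℂ)) = (1 - z) ^ (-(α : ℂ)) * (1 - z)⁻¹ := by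
      have h : -((α + 1 : ℝ) : ℂ) = -(α : ℂ) + -1 := by push_cast; ring
      rw [h, Complex.cpow_add _ _ h1z, Complex.cpow_neg_one]
    have hsα : s ^ (α : ℂ) ≠ 0 := by
      rw [Complex.cpow_def_of_ne_zero hs0]; exact Complex.exp_ne_zero _
    simp only [besselI, hterm, ← mul_assoc]
    rw [tsum_mul_right, tsum_mul_right, hneg]
    field_simp

theorem hilleHardyComplex_conj (α : ℝ) {x y : ℝ} (hx : 0 < x) (hy : 0 < y) {z : ℂ}
    (hz : ‖z‖ < 1) :
    hilleHardyComplex α x y (conj z) = conj (hilleHardyComplex α x y z) := by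
  have hre : 0 < (1 - z).re := by
    have := Complex.re_le_norm z
    simp only [Complex.sub_re, Complex.one_re]; linarith
  have harg : (1 - z).arg ≠ Real.pi := by
    intro h
    have h1 : |(1 - z).arg| < Real.pi / 2 := Complex.abs_arg_lt_pi_div_two_iff.2 (Or.inl hre)
    rw [h, abs_of_pos Real.pi_pos] at h1; linarith [Real.pi_pos]
  have hpow : (1 - conj z) ^ (-((α + 1 : ℝ) : ℂ)) =
      conj ((1 - z) ^ (-((α + 1 : ℝ) : ℂ))) := by
    have h := Complex.cpow_conj (1 - z) (-((α + 1 : ℝ) : ℂ)) harg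
    simp only [map_neg, Complex.conj_ofReal, map_sub, map_one] at h
    rw [h, Complex.conj_conj]
  rw [hilleHardyComplex_eq α hx hy hz,
    hilleHardyComplex_eq α hx hy (by rwa [RCLike.norm_conj]), hpow]
  simp only [map_mul, ← Complex.exp_conj, Complex.conj_tsum, map_div₀, map_neg, map_add, map_sub,
    map_one, map_pow, map_natCast, Complex.conj_ofReal]

theorem sliceExtension_slicePoint {F : ℂ → ℂ} {z : ℂ} (hF : F (conj z) = conj (F z))
    {I : ℍ} (hI : I * I = -1) :
    sliceExtension F (slicePoint I z) = slicePoint I (F z) := by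
  have hnorm : ‖I‖ = 1 := by
    have h : ‖I‖ * ‖I‖ = 1 := by rw [← norm_mul, hI, norm_neg, norm_one]
    nlinarith [norm_nonneg I]
  have hIre : I.re = 0 := by
    have h0 := congrArg QuaternionAlgebra.re hI
    have h1 := congrArg QuaternionAlgebra.imI hI
    have h2 := congrArg QuaternionAlgebra.imJ hI
    have h3 := congrArg QuaternionAlgebra.imK hI
    simp at h0 h1 h2 h3
    by_contra hne
    have e1 : I.imI = 0 := by
      have : I.re * I.imI = 0 := by linarith
      exact (mul_eq_zero.1 this).resolve_left hne
    have e2 : I.imJ = 0 := by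
      have : I.re * I.imJ = 0 := by linarith
      exact (mul_eq_zero.1 this).resolve_left hne
    have e3 : I.imK = 0 := by
      have : I.re * I.imK = 0 := by linarith
      exact (mul_eq_zero.1 this).resolve_left hne
    rw [e1, e2, e3] at h0
    nlinarith [sq_nonneg I.re]
  have hre : (slicePoint I z).re = z.re := by simp [slicePoint, hIre]
  have him : (slicePoint I z).im = z.im • I := by
    ext <;> simp [slicePoint, hIre]
  rw [sliceExtension, hre, him, norm_smul, hnorm, mul_one, Real.norm_eq_abs]
  rcases lt_trichotomy z.im 0 with h | h | h
  · have e : (⟨z.re, |z.im|⟩ : ℂ) = conj z := by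
      apply Complex.ext <;> simp [abs_of_neg h]
    have e2 : |z.im|⁻¹ * z.im = -1 := by
      rw [abs_of_neg h, inv_neg, neg_mul, inv_mul_cancel₀ h.ne]
    rw [e, hF, smul_smul, e2]
    simp [slicePoint]
  · have e : (⟨z.re, |z.im|⟩ : ℂ) = z := by
      apply Complex.ext <;> simp [h]
    have e2 : conj z = z := by
      apply Complex.ext <;> simp [h]
    have e3 : (F z).im = 0 := by
      rw [e2] at hF
      have := congrArg Complex.im hF
      simp at this; linarith
    rw [e]; simp [slicePoint, e3]
  · have e : (⟨z.re, |z.im|⟩ : ℂ) = z := by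
      apply Complex.ext <;> simp [abs_of_pos h]
    have e2 : |z.im|⁻¹ * z.im = 1 := by
      rw [abs_of_pos h, inv_mul_cancel₀ h.ne']
    rw [e, smul_smul, e2, one_smul]

theorem hilleHardyKernel_slicePoint (α : ℝ) {x y : ℝ} (hx : 0 < x) (hy : 0 < y) {z : ℂ}
    (hz : ‖z‖ < 1) {I : ℍ} (hI : I * I = -1) :
    hilleHardyKernel α (slicePoint I z) x y = slicePoint I (hilleHardyComplex α x y z) :=
  sliceExtension_slicePoint (hilleHardyComplex_conj α hx hy hz) hI

end

/-! Write `E` for `besselSeries α`. On the disc the kernel is `(1 - z)^(-(α+1)) exp(-z(x+y)/(1-z))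
E(zxy/(1-z)²)`, a holomorphic function `f` with real Taylor coefficients `c k`.

Reproducing formula: the conjugated Bergman kernel is a series `∑ a k • qᵏ p̄ᵏ`. The powers of `q`
stay on the left, and `p̄ᵏ f(p)` lies in one slice, so each term reduces to a complex moment. In
polar coordinates the angular integral extracts `c k` and the radial one is a Beta integral whose
product with `a k` is exactly 1 (`bergmanCoeff_mul_gamma`). What remains is `∑ c k • qᵏ`, the slice
extension of `f` at `q`; `q` need not lie in the slice of integration because the `c k` are real.

The analytic difficulty is absolute convergence for every `η > 0`. The bound `|f(z)| ≤ C
|1-z|^(-1/2)` (`exists_norm_hilleHardyComplex_le`) suffices: since `|1 - r e^{iθ}| ≥ |θ|/π`, the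
integrand has a majorant that is a product of an integrable function of `r` and one of `θ`. The
bound needs the sharp growth `|E(s²)| ≤ C (1+|s|)^(-(α+1/2)) exp(2|Re s|)`, obtained by a Grönwall
argument for the Bessel equation along rays. The exponential is absorbed by the exponential in `f`
because `2√(xy) ≤ x+y`, and the power factor lowers the exponent `-(α+1)` to `-1/2`.

Norm identity: up to a constant, `|f|² x^α e^{-x}` is `E(Ax) E(Āx) x^α e^{-px}`, with `A =
zy/(1-z)²` and `p = (1-|z|²)/|1-z|²`. Weber's integral evaluates this in closed form. It follows by
integrating the double series termwise and summing with a Gamma-function Vandermonde identity. -/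

/-! ### The entire Bessel series: convergence, derivative, recurrence. -/

/-- The entire function `∑ₙ wⁿ / (n! Γ(α + n + 1))`; up to a power, `I_α(ξ)` at `w = ξ² / 4`. -/
noncomputable def besselSeries (α : ℝ) (w : ℂ) : ℂ :=
  ∑' n : ℕ, (1 / ((n.factorial : ℂ) * (Real.Gamma (α + n + 1) : ℂ))) * w ^ n

theorem HasSum.congr_terms {ι E : Type*} [AddCommMonoid E] [TopologicalSpace E] {f g : ι → E} {a : E}
    (hg : HasSum g a) (h : ∀ i, f i = g i) : HasSum f a :=
  (funext h : f = g) ▸ hg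

theorem HasSum.mul_complex {ι κ : Type*} {f : ι → ℂ} {g : κ → ℂ} {a b : ℂ} (hf : HasSum f a)
    (hg : HasSum g b) : HasSum (fun i : ι × κ => f i.1 * g i.2) (a * b) :=
  hf.mul hg (summable_mul_of_summable_norm hf.summable.norm hg.summable.norm)

theorem gamma_add_nat_pos {α : ℝ} (hα : -1 < α) (n : ℕ) : 0 < Real.Gamma (α + n + 1) :=
  Real.Gamma_pos_of_pos (by have : (0 : ℝ) ≤ n := n.cast_nonneg; linarith)

theorem gamma_add_nat_succ {α : ℝ} (hα : -1 < α) (n : ℕ) :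
    Real.Gamma (α + (n + 1 : ℕ) + 1) = (α + n + 1) * Real.Gamma (α + n + 1) := by
  have : (0 : ℝ) ≤ n := n.cast_nonneg
  rw [← Real.Gamma_add_one (by linarith)]
  congr 1; push_cast; ring

/-- The factor `α + n + 1` in the functional equation can be below 1 only at `n = 0`, so the
sequence is nondecreasing from `n = 1` on and its first two values bound it below. -/
theorem exists_pos_le_gamma_add_nat {α : ℝ} (hα : -1 < α) :
    ∃ c > 0, ∀ n : ℕ, c ≤ Real.Gamma (α + n + 1) := by
  refine ⟨min (Real.Gamma (α + (0 : ℕ) + 1)) (Real.Gamma (α + (1 : ℕ) + 1)),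
    lt_min (gamma_add_nat_pos hα 0) (gamma_add_nat_pos hα 1), fun n => ?_⟩
  rcases n with _ | n
  · exact min_le_left _ _
  · induction n with
    | zero => exact min_le_right _ _
    | succ n ih =>
      rw [gamma_add_nat_succ hα (n + 1)]
      refine ih.trans (le_mul_of_one_le_left (gamma_add_nat_pos hα _).le ?_)
      have : (0 : ℝ) ≤ n := n.cast_nonneg
      push_cast; linarith

theorem exists_norm_besselSeries_term_le {α : ℝ} (hα : -1 < α) :
    ∃ C : ℝ, ∀ (w : ℂ) (n : ℕ),
      ‖(1 / ((n.factorial : ℂ) * (Real.Gamma (α + n + 1) : ℂ))) * w ^ n‖ ≤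
        C * (‖w‖ ^ n / n.factorial) := by
  obtain ⟨c, hc, h⟩ := exists_pos_le_gamma_add_nat hα
  refine ⟨c⁻¹, fun w n => ?_⟩
  have hG := gamma_add_nat_pos hα n
  have hn : (0 : ℝ) < n.factorial := by exact_mod_cast n.factorial_pos
  rw [norm_mul, norm_div, norm_mul, norm_one, norm_pow, Complex.norm_natCast, Complex.norm_real,
    Real.norm_of_nonneg hG.le, one_div, mul_inv, div_eq_mul_inv]
  have : (Real.Gamma (α + n + 1))⁻¹ ≤ c⁻¹ := inv_anti₀ hc (h n)
  calc (n.factorial : ℝ)⁻¹ * (Real.Gamma (α + n + 1))⁻¹ * ‖w‖ ^ n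
      ≤ (n.factorial : ℝ)⁻¹ * c⁻¹ * ‖w‖ ^ n := by gcongr
    _ = _ := by ring

theorem summable_norm_besselSeries {α : ℝ} (hα : -1 < α) (w : ℂ) :
    Summable fun n : ℕ =>
      ‖(1 / ((n.factorial : ℂ) * (Real.Gamma (α + n + 1) : ℂ))) * w ^ n‖ := by
  obtain ⟨C, hC⟩ := exists_norm_besselSeries_term_le hα
  exact Summable.of_nonneg_of_le (fun _ => norm_nonneg _) (hC w)
    ((Real.summable_pow_div_factorial ‖w‖).mul_left C)

theorem hasSum_besselSeries {α : ℝ} (hα : -1 < α) (w : ℂ) :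
    HasSum (fun n : ℕ => (1 / ((n.factorial : ℂ) * (Real.Gamma (α + n + 1) : ℂ))) * w ^ n)
      (besselSeries α w) :=
  (summable_norm_besselSeries hα w).of_norm.hasSum

theorem besselSeries_conj (α : ℝ) (w : ℂ) :
    besselSeries α (conj w) = conj (besselSeries α w) := by
  simp only [besselSeries, Complex.conj_tsum, map_mul, map_div₀, map_one, map_pow, map_natCast,
    Complex.conj_ofReal]

/-- Termwise differentiation cancels one factor of `n!` and shifts the Gamma argument, which amounts
to raising `α` by 1. It is legitimate because the differentiated series has an exponential-type
majorant on the ball of radius `‖w‖ + 1`. -/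
theorem hasDerivAt_besselSeries {α : ℝ} (hα : -1 < α) (w : ℂ) :
    HasDerivAt (besselSeries α) (besselSeries (α + 1) w) w := by
  have hα' : -1 < α + 1 := by linarith
  obtain ⟨C, hC⟩ := exists_norm_besselSeries_term_le hα'
  set g' : ℕ → ℂ → ℂ := fun n z =>
    (1 / ((n.factorial : ℂ) * (Real.Gamma (α + n + 1) : ℂ))) * (n * z ^ (n - 1)) with hg'
  have hsucc : ∀ (n : ℕ) (z : ℂ), g' (n + 1) z =
      (1 / ((n.factorial : ℂ) * (Real.Gamma (α + 1 + n + 1) : ℂ))) * z ^ n := by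
    intro n z
    have e : α + (n + 1 : ℕ) + 1 = α + 1 + n + 1 := by push_cast; ring
    have hn : ((n + 1 : ℕ) : ℂ) ≠ 0 := by exact_mod_cast n.succ_ne_zero
    simp only [hg', e, Nat.factorial_succ, Nat.add_sub_cancel, Nat.cast_mul]
    field_simp
  have hC0 : 0 ≤ C := by
    have := (norm_nonneg _).trans (hC 0 0)
    simpa using this
  have key : HasDerivAt (besselSeries α) (∑' n, g' n w) w := by
    refine hasDerivAt_tsum_of_isPreconnected
      (u := fun n => if n = 0 then 0 else
        C * ((‖w‖ + 1) ^ (n - 1) / (n - 1).factorial))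
      (t := Metric.ball 0 (‖w‖ + 1)) (y₀ := w) ?_ Metric.isOpen_ball
      (convex_ball _ _).isPreconnected (fun n y _ => ?_) (fun n y hy => ?_) ?_
      (summable_norm_besselSeries hα w).of_norm ?_
    · rw [← summable_nat_add_iff 1]
      simpa using (Real.summable_pow_div_factorial (‖w‖ + 1)).mul_left C
    · exact (hasDerivAt_pow n y).const_mul _
    · rcases n with _ | n
      · simp [hg']
      · have hy' : ‖y‖ ≤ ‖w‖ + 1 := by simpa using (Metric.mem_ball.1 hy).le
        have e := hC y n
        rw [← hsucc] at e
        simp only [Nat.add_eq_zero_iff, one_ne_zero, and_false, if_false, Nat.add_sub_cancel]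
        refine e.trans ?_
        gcongr
    · simp
    · simp
  have h0 : ∑' n, g' n w = besselSeries (α + 1) w := by
    have hs : Summable fun n => g' n w := by
      rw [← summable_nat_add_iff 1]
      simp only [hsucc]
      exact (summable_norm_besselSeries hα' w).of_norm
    rw [hs.tsum_eq_zero_add]
    simp only [hsucc]
    simp [hg', besselSeries]
  rwa [h0] at key

theorem differentiable_besselSeries {α : ℝ} (hα : -1 < α) :
    Differentiable ℂ (besselSeries α) :=
  fun w => (hasDerivAt_besselSeries hα w).differentiableAt

/-- Compare coefficients: `(n + α + 1) / Γ(α + n + 2) = 1 / Γ(α + n + 1)`. Since raising `α`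
differentiates, this is Bessel's equation `w E'' + (α + 1) E' = E`. -/
theorem besselSeries_recurrence {α : ℝ} (hα : -1 < α) (w : ℂ) :
    w * besselSeries (α + 1 + 1) w + (α + 1) * besselSeries (α + 1) w = besselSeries α w := by
  have hα' : -1 < α + 1 := by linarith
  have hα'' : -1 < α + 1 + 1 := by linarith
  have h1 := (hasSum_besselSeries hα'' w).mul_left w
  have h2 := (hasSum_besselSeries hα' w).mul_left ((α : ℂ) + 1)
  have h1' : HasSum (fun n : ℕ =>
      n * ((1 / ((n.factorial : ℂ) * (Real.Gamma (α + 1 + n + 1) : ℂ))) * w ^ n))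
      (w * besselSeries (α + 1 + 1) w) := by
    rw [← hasSum_nat_add_iff' 1]
    simp only [Finset.range_one, Finset.sum_singleton, Nat.cast_zero, zero_mul, sub_zero]
    refine h1.congr_terms fun n => ?_
    have e : α + 1 + (n + 1 : ℕ) + 1 = α + 1 + 1 + n + 1 := by push_cast; ring
    have hn : ((n + 1 : ℕ) : ℂ) ≠ 0 := by exact_mod_cast n.succ_ne_zero
    rw [e, Nat.factorial_succ, Nat.cast_mul, pow_succ]
    field_simp
  refine ((h1'.add h2).unique ?_)
  refine (hasSum_besselSeries hα w).congr_terms fun n => ?_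
  have e : α + 1 + (n : ℝ) + 1 = α + (n + 1 : ℕ) + 1 := by push_cast; ring
  have h0 : (0 : ℝ) ≤ n := n.cast_nonneg
  have hG : (Real.Gamma (α + n + 1) : ℂ) ≠ 0 := by exact_mod_cast (gamma_add_nat_pos hα n).ne'
  have hG' : ((α : ℂ) + n + 1) ≠ 0 := by
    have : (α + n + 1 : ℝ) ≠ 0 := by linarith
    exact_mod_cast this
  rw [e, gamma_add_nat_succ hα]
  push_cast
  field_simp
  ring

theorem hilleHardyComplex_eq_besselSeries (α : ℝ) {x y : ℝ} (hx : 0 < x) (hy : 0 < y) {z : ℂ}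
    (hz : ‖z‖ < 1) :
    hilleHardyComplex α x y z =
      (1 - z) ^ (-((α + 1 : ℝ) : ℂ)) * Complex.exp (-(z * (x + y)) / (1 - z)) *
        besselSeries α (z * x * y / (1 - z) ^ 2) :=
  hilleHardyComplex_eq α hx hy hz

/-! ### Termwise integration and Weber's integral. -/

theorem integrable_and_hasSum_integral {X ι E : Type*} [MeasurableSpace X] {μ : Measure X}
    [NormedAddCommGroup E] [NormedSpace ℝ E] [CompleteSpace E] [Countable ι] {F : ι → X → E}
    {f : X → E}
    (hF : ∀ i, Integrable (F i) μ) (hs : Summable fun i => ∫ a, ‖F i a‖ ∂μ)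
    (hf : ∀ᵐ a ∂μ, HasSum (fun i => F i a) (f a)) :
    Integrable f μ ∧ HasSum (fun i => ∫ a, F i a ∂μ) (∫ a, f a ∂μ) := by
  have hae : (fun a => ∑' i, F i a) =ᵐ[μ] f := hf.mono fun a h => h.tsum_eq
  constructor
  · refine ⟨aestronglyMeasurable_of_tendsto_ae (Filter.atTop : Filter (Finset ι))
      (f := fun s a => ∑ i ∈ s, F i a)
      (fun s => Finset.aestronglyMeasurable_fun_sum s fun i _ => (hF i).1)
      (hf.mono fun a h => h), ?_⟩
    have h1 : ∫⁻ a, ‖f a‖ₑ ∂μ ≤ ∑' i, ∫⁻ a, ‖F i a‖ₑ ∂μ := by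
      rw [← lintegral_tsum fun i => (hF i).1.enorm]
      refine lintegral_mono_ae (hae.mono fun a h => ?_)
      rw [← h]
      exact enorm_tsum_le_tsum_enorm
    refine lt_of_le_of_lt h1 ?_
    have h2 : ∀ i, ∫⁻ a, ‖F i a‖ₑ ∂μ = ENNReal.ofReal (∫ a, ‖F i a‖ ∂μ) := fun i =>
      (ofReal_integral_norm_eq_lintegral_enorm (hF i)).symm
    simp only [h2]
    exact hs.tsum_ofReal_lt_top
  · rw [← integral_congr_ae hae]
    exact hasSum_integral_of_summable_integral_norm hF hs

/-- Chu–Vandermonde in Gamma form. Pascal's rule splits the sum for `m + 1` into the sum for `(m, n,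
α)` and `n` times the sum for `(m, n - 1, α + 1)`, hence the induction on `m` with `n` and `α` free.
-/
theorem sum_choose_mul_descFactorial_div_gamma (m n : ℕ) {α : ℝ} (hα : -1 < α) :
    ∑ k ∈ Finset.range (m + 1),
        (m.choose k : ℝ) * (n.descFactorial k : ℝ) / Real.Gamma (α + k + 1) =
      Real.Gamma (α + m + n + 1) / (Real.Gamma (α + m + 1) * Real.Gamma (α + n + 1)) := by
  induction m generalizing n α with
  | zero =>
    have h1 := (gamma_add_nat_pos hα n).ne'
    have h2 := (gamma_add_nat_pos hα 0).ne'
    simp at h2 ⊢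
    field_simp
  | succ m ih =>
    have hα' : -1 < α + 1 := by linarith
    have h1 := (gamma_add_nat_pos hα n).ne'
    have h2 := (gamma_add_nat_pos hα m).ne'
    have hm : (0 : ℝ) ≤ m := m.cast_nonneg
    have h3 : α + m + 1 ≠ 0 := by linarith
    have split : ∑ k ∈ Finset.range (m + 1 + 1),
        ((m + 1).choose k : ℝ) * (n.descFactorial k : ℝ) / Real.Gamma (α + k + 1) =
      ∑ k ∈ Finset.range (m + 1),
        (m.choose k : ℝ) * (n.descFactorial k : ℝ) / Real.Gamma (α + k + 1) +
      ∑ k ∈ Finset.range (m + 1),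
        (m.choose k : ℝ) * (n.descFactorial (k + 1) : ℝ) / Real.Gamma (α + 1 + k + 1) := by
      have e : ∀ k ∈ Finset.range (m + 1),
          ((m + 1).choose (k + 1) : ℝ) * (n.descFactorial (k + 1) : ℝ) /
            Real.Gamma (α + (k + 1 : ℕ) + 1) =
          (m.choose k : ℝ) * (n.descFactorial (k + 1) : ℝ) / Real.Gamma (α + 1 + k + 1) +
          (m.choose (k + 1) : ℝ) * (n.descFactorial (k + 1) : ℝ) /
            Real.Gamma (α + (k + 1 : ℕ) + 1) := by
        intro k _
        have : α + (k + 1 : ℕ) + 1 = α + 1 + k + 1 := by push_cast; ring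
        rw [Nat.choose_succ_succ, this]
        push_cast
        ring
      have h := Finset.sum_range_succ' (fun k => (m.choose k : ℝ) * (n.descFactorial k : ℝ) /
        Real.Gamma (α + k + 1)) (m + 1)
      rw [Finset.sum_range_succ] at h
      simp only [Nat.choose_succ_self, Nat.choose_zero_right, Nat.cast_zero, zero_mul, zero_div,
        add_zero] at h
      rw [Finset.sum_range_succ', Finset.sum_congr rfl e, Finset.sum_add_distrib, h]
      simp only [Nat.choose_zero_right, Nat.cast_zero, add_zero]
      ring
    rw [split, ih n hα, gamma_add_nat_succ hα m]
    have hmn : α + (m + 1 : ℕ) + n + 1 = α + (m + n + 1 : ℕ) + 1 := by push_cast; ring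
    have hmn' : α + m + n + 1 = α + (m + n : ℕ) + 1 := by push_cast; ring
    rw [hmn, hmn', gamma_add_nat_succ hα (m + n)]
    rcases n with _ | n
    · simp
      field_simp
    · have e : ∀ k ∈ Finset.range (m + 1),
          (m.choose k : ℝ) * ((n + 1).descFactorial (k + 1) : ℝ) / Real.Gamma (α + 1 + k + 1) =
          (n + 1) * ((m.choose k : ℝ) * (n.descFactorial k : ℝ) /
            Real.Gamma (α + 1 + k + 1)) := by
        intro k _
        rw [Nat.succ_descFactorial_succ]
        push_cast
        ring
      rw [Finset.sum_congr rfl e, ← Finset.mul_sum, ih n hα']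
      have e1 : α + 1 + m + n + 1 = α + (m + (n + 1) : ℕ) + 1 := by push_cast; ring
      have e2 : α + 1 + m + 1 = α + (m + 1 : ℕ) + 1 := by push_cast; ring
      have e3 : α + 1 + n + 1 = α + (n + 1 : ℕ) + 1 := by push_cast; ring
      rw [e1, e2, e3, gamma_add_nat_succ hα m]
      push_cast at h1 ⊢
      field_simp
      ring

/-- Collects the `aᵐ bⁿ` terms in the product of the series of `exp a`, `exp b` and `E(ab)`: the
third series contributes index `k`, the exponentials `m - k` and `n - k`. -/
theorem sum_besselSeries_fiber {α : ℝ} (hα : -1 < α) (a b : ℂ) (m n : ℕ) :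
    ∑ k ∈ Finset.range (min m n + 1), a ^ (m - k) / ((m - k).factorial : ℂ) *
      (b ^ (n - k) / ((n - k).factorial : ℂ) * (1 / ((k.factorial : ℂ) *
        (Real.Gamma (α + k + 1) : ℂ)) * (a * b) ^ k)) =
    (Real.Gamma (α + m + n + 1) / (m.factorial * n.factorial *
          Real.Gamma (α + m + 1) * Real.Gamma (α + n + 1)) : ℝ) * (a ^ m * b ^ n) := by
  have hV := sum_choose_mul_descFactorial_div_gamma m n hα
  have hsub : Finset.range (min m n + 1) ⊆ Finset.range (m + 1) := by
    intro k; simp only [Finset.mem_range]; omega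
  rw [← Finset.sum_subset hsub] at hV
  swap
  · intro k hk hk'
    simp only [Finset.mem_range] at hk hk'
    rw [Nat.descFactorial_of_lt (by omega)]
    simp
  have hm : ((m.factorial : ℕ) : ℂ) ≠ 0 := by exact_mod_cast m.factorial_ne_zero
  have hn : ((n.factorial : ℕ) : ℂ) ≠ 0 := by exact_mod_cast n.factorial_ne_zero
  have hmR : ((m.factorial : ℕ) : ℝ) ≠ 0 := by exact_mod_cast m.factorial_ne_zero
  have hnR : ((n.factorial : ℕ) : ℝ) ≠ 0 := by exact_mod_cast n.factorial_ne_zero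
  have hlhs : (Real.Gamma (α + m + n + 1) / (m.factorial * n.factorial *
          Real.Gamma (α + m + 1) * Real.Gamma (α + n + 1)) : ℝ) =
      (∑ k ∈ Finset.range (min m n + 1),
        (m.choose k : ℝ) * (n.descFactorial k : ℝ) / Real.Gamma (α + k + 1)) /
        (m.factorial * n.factorial) := by
    rw [hV, div_div]; congr 1; ring
  rw [hlhs, Finset.sum_div]
  push_cast
  rw [Finset.sum_mul]
  refine Finset.sum_congr rfl fun k hk => ?_
  simp only [Finset.mem_range] at hk
  have hkm : k ≤ m := by omega
  have hkn : k ≤ n := by omega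
  have hG : (Real.Gamma (α + k + 1) : ℂ) ≠ 0 := by exact_mod_cast (gamma_add_nat_pos hα k).ne'
  have hk0 : ((k.factorial : ℕ) : ℂ) ≠ 0 := by exact_mod_cast k.factorial_ne_zero
  have hmk0 : (((m - k).factorial : ℕ) : ℂ) ≠ 0 := by exact_mod_cast (m - k).factorial_ne_zero
  have hnk0 : (((n - k).factorial : ℕ) : ℂ) ≠ 0 := by exact_mod_cast (n - k).factorial_ne_zero
  have c1 : (m.choose k : ℂ) = m.factorial / (k.factorial * (m - k).factorial) := by
    rw [Nat.cast_choose ℂ hkm]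
  have c2 : (n.descFactorial k : ℂ) = n.factorial / (n - k).factorial := by
    rw [eq_div_iff hnk0, mul_comm]
    exact_mod_cast Nat.factorial_mul_descFactorial hkn
  have pa : a ^ m = a ^ (m - k) * a ^ k := by rw [← pow_add]; congr 1; omega
  have pb : b ^ n = b ^ (n - k) * b ^ k := by rw [← pow_add]; congr 1; omega
  rw [c1, c2, pa, pb, mul_pow]
  field_simp

theorem hasSum_exp_mul_exp_mul_besselSeries {α : ℝ} (hα : -1 < α) (a b : ℂ) :
    HasSum (fun i : ℕ × ℕ =>
        (Real.Gamma (α + i.1 + i.2 + 1) / (i.1.factorial * i.2.factorial *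
          Real.Gamma (α + i.1 + 1) * Real.Gamma (α + i.2 + 1)) : ℝ) * (a ^ i.1 * b ^ i.2))
      (Complex.exp a * Complex.exp b * besselSeries α (a * b)) := by
  have hexp : ∀ w : ℂ, HasSum (fun n : ℕ => w ^ n / (n.factorial : ℂ)) (Complex.exp w) := by
    intro w
    rw [Complex.exp_eq_exp_ℂ]
    exact NormedSpace.expSeries_div_hasSum_exp w
  have hE := hasSum_besselSeries hα (a * b)
  set F : ℕ × ℕ × ℕ → ℂ := fun t => a ^ t.1 / (t.1.factorial : ℂ) * (b ^ t.2.1 /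
      (t.2.1.factorial : ℂ) * (1 / ((t.2.2.factorial : ℂ) *
        (Real.Gamma (α + t.2.2 + 1) : ℂ)) * (a * b) ^ t.2.2)) with hF
  have h2 : HasSum F (Complex.exp a * (Complex.exp b * besselSeries α (a * b))) := by
    have h1 := (hexp b).mul_complex hE
    have h2 := (hexp a).mul_complex h1
    exact h2
  -- Regroup the triple series by total exponents of `a` and `b`; each fibre is finite and
  -- parametrized by the index of the Bessel series.
  have h3 := h2.tsum_fiberwise (fun t : ℕ × ℕ × ℕ => (t.1 + t.2.2, t.2.1 + t.2.2))
  rw [mul_assoc]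
  refine h3.congr_terms fun i => ?_
  obtain ⟨m, n⟩ := i
  set φ : ℕ → ℕ × ℕ × ℕ := fun k => (m - k, n - k, k) with hφ
  have hfib : (fun t : ℕ × ℕ × ℕ => (t.1 + t.2.2, t.2.1 + t.2.2)) ⁻¹' {(m, n)} =
      ((Finset.range (min m n + 1)).image φ : Finset (ℕ × ℕ × ℕ)) := by
    ext ⟨i, j, k⟩
    simp only [Set.mem_preimage, Set.mem_singleton_iff, Prod.mk.injEq, Finset.coe_image,
      Finset.coe_range, Set.mem_image, Set.mem_Iio, hφ]
    constructor
    · rintro ⟨h, h'⟩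
      exact ⟨k, by omega, by omega, by omega, rfl⟩
    · rintro ⟨l, h, h', h'', rfl⟩
      omega
  rw [hfib, Finset.tsum_subtype' ((Finset.range (min m n + 1)).image φ) F,
    Finset.sum_image (fun k _ l _ h => congrArg (fun t : ℕ × ℕ × ℕ => t.2.2) h)]
  exact (sum_besselSeries_fiber hα a b m n).symm

/-- Weber's second exponential integral. -/
theorem integral_besselSeries_mul_besselSeries {α : ℝ} (hα : -1 < α) (A B : ℂ) {p : ℝ}
    (hp : 0 < p) :
    IntegrableOn (fun x : ℝ => besselSeries α (A * x) * besselSeries α (B * x) *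
      ((x ^ α * Real.exp (-(p * x)) : ℝ) : ℂ)) (Set.Ioi 0) ∧
    ∫ x in Set.Ioi (0 : ℝ), besselSeries α (A * x) * besselSeries α (B * x) *
      ((x ^ α * Real.exp (-(p * x)) : ℝ) : ℂ) =
    (((1 / p) ^ (α + 1) : ℝ) : ℂ) *
      (Complex.exp (A / p) * Complex.exp (B / p) * besselSeries α (A / p * (B / p))) := by
  set c : ℕ × ℕ → ℝ := fun i => 1 / (i.1.factorial * i.2.factorial *
    Real.Gamma (α + i.1 + 1) * Real.Gamma (α + i.2 + 1)) with hc
  have hc0 : ∀ i, 0 < c i := fun i => by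
    have h1 := gamma_add_nat_pos hα i.1
    have h2 := gamma_add_nat_pos hα i.2
    have h3 : (0 : ℝ) < i.1.factorial := by exact_mod_cast i.1.factorial_pos
    have h4 : (0 : ℝ) < i.2.factorial := by exact_mod_cast i.2.factorial_pos
    simp only [hc]; positivity
  set w : ℕ × ℕ → ℝ → ℝ := fun i x => x ^ (α + i.1 + i.2) * Real.exp (-(p * x)) with hw
  set F : ℕ × ℕ → ℝ → ℂ := fun i x => ((c i : ℝ) : ℂ) * (A ^ i.1 * B ^ i.2) * (w i x : ℂ) with hF
  have hpos : ∀ i : ℕ × ℕ, 0 < α + i.1 + i.2 + 1 := fun i => by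
    have h1 : (0 : ℝ) ≤ i.1 := i.1.cast_nonneg
    have h2 : (0 : ℝ) ≤ i.2 := i.2.cast_nonneg
    linarith
  have hwint : ∀ i, IntegrableOn (w i) (Set.Ioi 0) := fun i => by
    have := integrableOn_rpow_mul_exp_neg_mul_rpow (p := 1) (s := α + i.1 + i.2) (b := p)
      (by linarith [hpos i]) one_pos hp
    simpa [hw] using this
  have hwval : ∀ i, ∫ x in Set.Ioi (0 : ℝ), w i x =
      (1 / p) ^ (α + 1) * (1 / p) ^ i.1 * (1 / p) ^ i.2 * Real.Gamma (α + i.1 + i.2 + 1) :=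
    fun i => by
    have := Real.integral_rpow_mul_exp_neg_mul_Ioi (hpos i) hp
    have e : α + i.1 + i.2 + 1 = (α + 1) + i.1 + i.2 := by ring
    rw [add_sub_cancel_right] at this
    simp only [hw, this]
    nth_rw 1 [e]
    rw [Real.rpow_add (by positivity), Real.rpow_add (by positivity), Real.rpow_natCast,
      Real.rpow_natCast]
  have hFint : ∀ i, Integrable (F i) (volume.restrict (Set.Ioi 0)) := fun i =>
    (Integrable.ofReal (hwint i)).const_mul _
  have hFval : ∀ i, ∫ x in Set.Ioi (0 : ℝ), F i x = (((1 / p) ^ (α + 1) : ℝ) : ℂ) *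
      ((Real.Gamma (α + i.1 + i.2 + 1) / (i.1.factorial * i.2.factorial *
          Real.Gamma (α + i.1 + 1) * Real.Gamma (α + i.2 + 1)) : ℝ) *
        ((A / p) ^ i.1 * (B / p) ^ i.2)) := fun i => by
    simp only [hF]
    rw [integral_const_mul, integral_complex_ofReal, hwval]
    simp only [hc]
    push_cast
    simp only [div_eq_mul_inv, mul_inv, one_mul, mul_pow]
    ring
  have hFnorm : ∀ i, ∫ x in Set.Ioi (0 : ℝ), ‖F i x‖ = ‖(((1 / p) ^ (α + 1) : ℝ) : ℂ) *
      ((Real.Gamma (α + i.1 + i.2 + 1) / (i.1.factorial * i.2.factorial *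
          Real.Gamma (α + i.1 + 1) * Real.Gamma (α + i.2 + 1)) : ℝ) *
        ((A / p) ^ i.1 * (B / p) ^ i.2))‖ := fun i => by
    have : ∀ x ∈ Set.Ioi (0 : ℝ), ‖F i x‖ = c i * (‖A‖ ^ i.1 * ‖B‖ ^ i.2) * w i x := by
      intro x hx
      have hx' : (0 : ℝ) < x := hx
      have : 0 ≤ w i x := by simp only [hw]; positivity
      simp only [hF, norm_mul, norm_pow, Complex.norm_real, Real.norm_of_nonneg (hc0 i).le,
        Real.norm_of_nonneg this]
    have hG : 0 < Real.Gamma (α + i.1 + i.2 + 1) := Real.Gamma_pos_of_pos (hpos i)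
    have h1 := gamma_add_nat_pos hα i.1
    have h2 := gamma_add_nat_pos hα i.2
    rw [setIntegral_congr_fun measurableSet_Ioi this, integral_const_mul, hwval]
    simp only [norm_mul, norm_pow, norm_div, Complex.norm_real, Real.norm_eq_abs]
    rw [abs_of_pos hp, abs_of_pos (by positivity : (0:ℝ) < (1 / p) ^ (α + 1)), abs_of_pos hG,
      abs_of_pos h1, abs_of_pos h2, Nat.abs_cast, Nat.abs_cast]
    simp only [hc, div_eq_mul_inv, mul_inv, one_mul, mul_pow]
    ring
  have hsum := (hasSum_exp_mul_exp_mul_besselSeries hα (A / p) (B / p)).mul_left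
    (((1 / p) ^ (α + 1) : ℝ) : ℂ)
  have key := integrable_and_hasSum_integral (μ := volume.restrict (Set.Ioi (0 : ℝ)))
    (F := F) (f := fun x : ℝ => besselSeries α (A * x) * besselSeries α (B * x) *
      ((x ^ α * Real.exp (-(p * x)) : ℝ) : ℂ)) hFint
    (by simp only [hFnorm]; exact hsum.summable.norm) ?_
  · refine ⟨key.1, key.2.unique ?_⟩
    simp only [hFval]
    exact hsum
  · refine (ae_restrict_iff' measurableSet_Ioi).2 (Filter.Eventually.of_forall fun x hx => ?_)
    have hx' : (0 : ℝ) < x := hx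
    have hA := hasSum_besselSeries hα (A * x)
    have hB := hasSum_besselSeries hα (B * x)
    have := (hA.mul_complex hB).mul_right ((x ^ α * Real.exp (-(p * x)) : ℝ) : ℂ)
    refine this.congr_terms fun i => ?_
    simp only [hF, hw, hc]
    rw [Real.rpow_add hx', Real.rpow_add hx', Real.rpow_natCast, Real.rpow_natCast]
    push_cast
    simp only [mul_pow, div_eq_mul_inv, mul_inv, one_mul]
    ring

/-! ### The norm identity on the complex disc. -/

theorem one_sub_re_pos {z : ℂ} (hz : ‖z‖ < 1) : 0 < (1 - z).re := by
  have := Complex.re_le_norm z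
  simp only [Complex.sub_re, Complex.one_re]; linarith

theorem one_sub_ne_zero {z : ℂ} (hz : ‖z‖ < 1) : 1 - z ≠ 0 := fun h => by
  have := one_sub_re_pos hz
  rw [h] at this
  simp at this

theorem div_one_sub_add_conj {z : ℂ} (hz : ‖z‖ < 1) :
    1 + 2 * (z / (1 - z)).re = (1 - ‖z‖ ^ 2) / ‖1 - z‖ ^ 2 := by
  have h : Complex.normSq (1 - z) ≠ 0 := (Complex.normSq_pos.2 (one_sub_ne_zero hz)).ne'
  rw [← Complex.normSq_eq_norm_sq, ← Complex.normSq_eq_norm_sq, Complex.div_re]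
  field_simp
  simp only [Complex.normSq_apply, Complex.sub_re, Complex.sub_im, Complex.one_re, Complex.one_im]
  ring

/-- Weber's integral with parameters `A` and `conj A`. The decay rate is `p = 1 + 2 Re(z/(1-z))`,
and `|A|/p = |z| y/(1-|z|²)` gives the Bessel argument of the diagonal kernel at `|z|²`. -/
theorem integral_norm_hilleHardyComplex_sq {α : ℝ} (hα : -1 < α) {y : ℝ} (hy : 0 < y) {z : ℂ}
    (hz : ‖z‖ < 1) :
    IntegrableOn (fun x : ℝ => ‖hilleHardyComplex α x y z‖ ^ 2 * (x ^ α * Real.exp (-x)))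
      (Set.Ioi 0) ∧
    hilleHardyComplex α y y ((‖z‖ ^ 2 : ℝ) : ℂ) =
      ((∫ x in Set.Ioi (0 : ℝ),
        ‖hilleHardyComplex α x y z‖ ^ 2 * (x ^ α * Real.exp (-x)) : ℝ) : ℂ) := by
  have h1z := one_sub_ne_zero hz
  have hn : 0 < ‖1 - z‖ := norm_pos_iff.2 h1z
  have hρ : 0 < 1 - ‖z‖ ^ 2 := by nlinarith [norm_nonneg z]
  set p : ℝ := (1 - ‖z‖ ^ 2) / ‖1 - z‖ ^ 2 with hp
  have hp0 : 0 < p := by positivity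
  have hpre : 1 + 2 * (z / (1 - z)).re = p := div_one_sub_add_conj hz
  set A : ℂ := z * y / (1 - z) ^ 2 with hA
  set D : ℝ := (‖1 - z‖ ^ (-(α + 1)) * Real.exp (-(y * (z / (1 - z)).re))) ^ 2 with hD
  obtain ⟨hint, hval⟩ := integral_besselSeries_mul_besselSeries hα A (conj A) hp0
  have hpt : ∀ x ∈ Set.Ioi (0 : ℝ),
      ((‖hilleHardyComplex α x y z‖ ^ 2 * (x ^ α * Real.exp (-x)) : ℝ) : ℂ) =
      (D : ℂ) * (besselSeries α (A * x) * besselSeries α (conj A * x) *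
        ((x ^ α * Real.exp (-(p * x)) : ℝ) : ℂ)) := by
    intro x hx
    have hx' : (0 : ℝ) < x := hx
    have e1 : z * x * y / (1 - z) ^ 2 = A * x := by rw [hA]; ring
    have e2 : besselSeries α (conj A * x) = conj (besselSeries α (A * x)) := by
      rw [← besselSeries_conj, map_mul, Complex.conj_ofReal]
    have e3 : (-(z * (x + y)) / (1 - z)).re = -((x + y) * (z / (1 - z)).re) := by
      have : -(z * (x + y)) / (1 - z) = ((-(x + y) : ℝ) : ℂ) * (z / (1 - z)) := by
        push_cast; ring
      rw [this, Complex.re_ofReal_mul]; ring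
    have e4 : Real.exp (-((x + y) * (z / (1 - z)).re)) ^ 2 * Real.exp (-x) =
        Real.exp (-(y * (z / (1 - z)).re)) ^ 2 * Real.exp (-(p * x)) := by
      rw [← Real.exp_nat_mul, ← Real.exp_nat_mul, ← Real.exp_add, ← Real.exp_add, ← hpre]
      congr 1; push_cast; ring
    rw [e2, Complex.mul_conj, Complex.normSq_eq_norm_sq,
      hilleHardyComplex_eq_besselSeries α hx' hy hz, e1, norm_mul, norm_mul,
      ← Complex.ofReal_neg, Complex.norm_cpow_real, Complex.norm_exp, e3]
    norm_cast
    rw [hD]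
    linear_combination (‖1 - z‖ ^ (-(α + 1)) * ‖besselSeries α (A * x)‖) ^ 2 * x ^ α * e4
  have hint' : IntegrableOn (fun x : ℝ =>
      ((‖hilleHardyComplex α x y z‖ ^ 2 * (x ^ α * Real.exp (-x)) : ℝ) : ℂ)) (Set.Ioi 0) :=
    (integrableOn_congr_fun hpt measurableSet_Ioi).2 (hint.const_mul (D : ℂ))
  refine ⟨hint'.re.congr (Filter.Eventually.of_forall fun x => Complex.ofReal_re _), ?_⟩
  rw [← integral_complex_ofReal, setIntegral_congr_fun measurableSet_Ioi hpt, integral_const_mul,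
    hval]
  have hzz : ‖((‖z‖ ^ 2 : ℝ) : ℂ)‖ < 1 := by
    rw [Complex.norm_real, Real.norm_of_nonneg (by positivity)]; linarith
  rw [hilleHardyComplex_eq_besselSeries α hy hy hzz]
  have hAA : A / p * (conj A / p) = ((‖z‖ ^ 2 : ℝ) : ℂ) * y * y / (1 - ((‖z‖ ^ 2 : ℝ) : ℂ)) ^ 2 := by
    have e : A / p * (conj A / p) = ((‖A‖ ^ 2 / p ^ 2 : ℝ) : ℂ) := by
      rw [← Complex.normSq_eq_norm_sq]
      push_cast
      rw [← Complex.mul_conj]; field_simp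
    rw [e]
    norm_cast
    rw [hA, hp, norm_div, norm_mul, norm_pow, Complex.norm_real, Real.norm_of_nonneg hy.le]
    field_simp
  have hexp : Complex.exp (A / p) * Complex.exp (conj A / p) =
      ((Real.exp (2 * A.re / p) : ℝ) : ℂ) := by
    rw [← Complex.exp_add, ← add_div, Complex.add_conj]
    norm_cast
  -- The exponential produced by Weber's integral, combined with the one in `D`, must give the
  -- exponential of the kernel at `|z|²`.
  have hAre : 2 * A.re / p - 2 * (y * (z / (1 - z)).re) = -(2 * y * ‖z‖ ^ 2 / (1 - ‖z‖ ^ 2)) := by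
    have h : Complex.normSq (1 - z) ≠ 0 := (Complex.normSq_pos.2 h1z).ne'
    have e1 : A.re = y * ((z * (1 - conj z) ^ 2).re / Complex.normSq (1 - z) ^ 2) := by
      have : A = (y : ℂ) * (z * (1 - conj z) ^ 2) / ((Complex.normSq (1 - z) ^ 2 : ℝ) : ℂ) := by
        have h2 : (1 - conj z) ≠ 0 := one_sub_ne_zero (by simpa using hz)
        have h3 : ((Complex.normSq (1 - z) : ℝ) : ℂ) = (1 - z) * (1 - conj z) := by
          rw [← Complex.mul_conj]; simp
        rw [hA, Complex.ofReal_pow, h3]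
        field_simp
      rw [this, Complex.div_ofReal_re, Complex.re_ofReal_mul]; ring
    have hρ' : 1 - Complex.normSq z ≠ 0 := by rw [Complex.normSq_eq_norm_sq]; exact hρ.ne'
    rw [hp, e1, ← Complex.normSq_eq_norm_sq, ← Complex.normSq_eq_norm_sq, Complex.div_re]
    field_simp
    simp only [Complex.normSq_apply, Complex.sub_re, Complex.sub_im, Complex.one_re,
      Complex.one_im, Complex.mul_re, Complex.mul_im, Complex.conj_re, Complex.conj_im, pow_two]
    ring
  have hpow : ((1 - ((‖z‖ ^ 2 : ℝ) : ℂ)) ^ (-((α + 1 : ℝ) : ℂ))) =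
      (((1 - ‖z‖ ^ 2) ^ (-(α + 1)) : ℝ) : ℂ) := by
    rw [Complex.ofReal_cpow hρ.le]; push_cast; rfl
  have hexp' : Complex.exp (-(((‖z‖ ^ 2 : ℝ) : ℂ) * (y + y)) / (1 - ((‖z‖ ^ 2 : ℝ) : ℂ))) =
      ((Real.exp (-(2 * y * ‖z‖ ^ 2 / (1 - ‖z‖ ^ 2))) : ℝ) : ℂ) := by
    push_cast
    congr 1; ring
  have hscalar : (1 - ‖z‖ ^ 2) ^ (-(α + 1)) *
      Real.exp (2 * A.re / p - 2 * (y * (z / (1 - z)).re)) =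
      D * (1 / p) ^ (α + 1) * Real.exp (2 * A.re / p) := by
    have e : D = ‖1 - z‖ ^ (-(2 * (α + 1))) * Real.exp (-(2 * (y * (z / (1 - z)).re))) := by
      rw [hD, mul_pow, ← Real.exp_nat_mul, ← Real.rpow_natCast, ← Real.rpow_mul hn.le]
      congr 2 <;> (push_cast; ring)
    have e' : (‖1 - z‖ ^ 2) ^ (α + 1) = ‖1 - z‖ ^ (2 * (α + 1)) := by
      rw [← Real.rpow_natCast, ← Real.rpow_mul hn.le]; norm_cast
    have e3 : (1 / p) ^ (α + 1) = ‖1 - z‖ ^ (2 * (α + 1)) / (1 - ‖z‖ ^ 2) ^ (α + 1) := by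
      rw [hp, one_div_div, Real.div_rpow (by positivity) hρ.le, e']
    rw [e, e3, Real.rpow_neg hρ.le, Real.rpow_neg hn.le,
      sub_eq_add_neg (2 * A.re / p), Real.exp_add]
    have : 0 < ‖1 - z‖ ^ (2 * (α + 1)) := by positivity
    field_simp
  rw [hAA, hexp, hexp', hpow, ← hAre, ← Complex.ofReal_mul, hscalar]
  push_cast
  ring

/-! ### Growth of the Bessel series and of the kernel near the boundary. -/

theorem rpow_le_rpow_abs {m t : ℝ} (ht : 0 < t) (h1 : m⁻¹ ≤ t) (h2 : t ≤ m) (b : ℝ) :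
    t ^ b ≤ m ^ |b| := by
  rcases le_total 0 b with hb | hb
  · rw [abs_of_nonneg hb]
    exact Real.rpow_le_rpow ht.le h2 hb
  · have hm : 0 < m := ht.trans_le h2
    rw [abs_of_nonpos hb, ← inv_inv t, Real.inv_rpow (by positivity), ← Real.rpow_neg (by positivity)]
    exact Real.rpow_le_rpow (by positivity) (inv_le_of_inv_le₀ hm h1) (by linarith)

/-- A Grönwall estimate for the diagonalized system of `f'' = (4 ε² + k / ρ²) f`. -/
theorem norm_sq_add_norm_sq_le_of_hasDerivAt {u v h : ℝ → ℂ} {ε : ℂ} (hε : ‖ε‖ = 1)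
    (hre : 0 ≤ ε.re) (k : ℝ)
    (hu : ∀ ρ > 0, HasDerivAt u (2 * ε * u ρ + ((k / ρ ^ 2 : ℝ) : ℂ) * h ρ) ρ)
    (hv : ∀ ρ > 0, HasDerivAt v (-(2 * ε * v ρ) + ((k / ρ ^ 2 : ℝ) : ℂ) * h ρ) ρ)
    (hh : ∀ ρ > 0, 4 * ε * h ρ = u ρ - v ρ) {ρ : ℝ} (hρ : 1 ≤ ρ) :
    ‖u ρ‖ ^ 2 + ‖v ρ‖ ^ 2 ≤
      (‖u 1‖ ^ 2 + ‖v 1‖ ^ 2) * Real.exp |k| * Real.exp (4 * ε.re * ρ) := by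
  set N : ℝ → ℝ := fun ρ => ‖u ρ‖ ^ 2 + ‖v ρ‖ ^ 2 with hN
  -- Integrating factor for `N' ≤ (4 Re ε + |k|/ρ²) N`. As `1/ρ²` is integrable at infinity, the
  -- perturbation costs only the constant `exp |k|`.
  set W : ℝ → ℝ := fun ρ => Real.exp (-(4 * ε.re) * ρ + |k| * ρ⁻¹) with hW
  set N' : ℝ → ℝ := fun ρ =>
    2 * inner ℝ (u ρ) (2 * ε * u ρ + ((k / ρ ^ 2 : ℝ) : ℂ) * h ρ) +
      2 * inner ℝ (v ρ) (-(2 * ε * v ρ) + ((k / ρ ^ 2 : ℝ) : ℂ) * h ρ) with hN'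
  set W' : ℝ → ℝ := fun ρ => W ρ * (-(4 * ε.re) + |k| * (-(ρ ^ 2)⁻¹)) with hW'
  have dN : ∀ ρ > 0, HasDerivAt N (N' ρ) ρ := fun ρ h0 => (hu ρ h0).norm_sq.add (hv ρ h0).norm_sq
  have dW : ∀ ρ > 0, HasDerivAt W (W' ρ) ρ := fun ρ h0 => by
    have h1 : HasDerivAt (fun ρ : ℝ => -(4 * ε.re) * ρ) (-(4 * ε.re)) ρ :=
      ((hasDerivAt_id' ρ).const_mul (-(4 * ε.re))).congr_deriv (mul_one _)
    exact (h1.add ((hasDerivAt_inv h0.ne').const_mul |k|)).exp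
  have dM : ∀ ρ > 0, HasDerivAt (fun ρ => N ρ * W ρ) (N' ρ * W ρ + N ρ * W' ρ) ρ :=
    fun ρ h0 => (dN ρ h0).mul (dW ρ h0)
  have inner_self : ∀ w : ℂ, inner ℝ w (2 * ε * w) = 2 * ε.re * ‖w‖ ^ 2 := by
    intro w
    rw [← Complex.normSq_eq_norm_sq, Complex.inner, Complex.normSq_apply]
    simp
    ring
  have hbound : ∀ ρ > 0, N' ρ * W ρ + N ρ * W' ρ ≤ 0 := fun ρ h0 => by
    have hW0 : 0 < W ρ := Real.exp_pos _
    have hV : 0 ≤ |k| * (ρ ^ 2)⁻¹ := by positivity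
    have hnorm : ‖((k / ρ ^ 2 : ℝ) : ℂ) * h ρ‖ ≤ |k| * (ρ ^ 2)⁻¹ * ((‖u ρ‖ + ‖v ρ‖) / 4) := by
      have h4 : 4 * ‖h ρ‖ ≤ ‖u ρ‖ + ‖v ρ‖ := by
        have := norm_sub_le (u ρ) (v ρ)
        rw [← hh ρ h0, norm_mul, norm_mul, hε] at this
        simpa using this
      rw [norm_mul, Complex.norm_real, norm_div, Real.norm_eq_abs, norm_pow, Real.norm_eq_abs,
        sq_abs, div_eq_mul_inv]
      gcongr
      linarith
    have i1 := (le_abs_self _).trans (abs_real_inner_le_norm (u ρ) (((k / ρ ^ 2 : ℝ) : ℂ) * h ρ))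
    have i2 := (le_abs_self _).trans (abs_real_inner_le_norm (v ρ) (((k / ρ ^ 2 : ℝ) : ℂ) * h ρ))
    have i1' := i1.trans (mul_le_mul_of_nonneg_left hnorm (norm_nonneg (u ρ)))
    have i2' := i2.trans (mul_le_mul_of_nonneg_left hnorm (norm_nonneg (v ρ)))
    have hle : N' ρ ≤ (4 * ε.re + |k| * (ρ ^ 2)⁻¹) * N ρ := by
      simp only [hN', hN, inner_add_right, inner_neg_right, inner_self]
      have s1 : 0 ≤ |k| * (ρ ^ 2)⁻¹ * (‖u ρ‖ - ‖v ρ‖) ^ 2 := mul_nonneg hV (sq_nonneg _)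
      have s2 : 0 ≤ ε.re * ‖v ρ‖ ^ 2 := mul_nonneg hre (sq_nonneg _)
      nlinarith
    have : N' ρ * W ρ + N ρ * W' ρ = (N' ρ - (4 * ε.re + |k| * (ρ ^ 2)⁻¹) * N ρ) * W ρ := by
      simp only [hW']; ring
    rw [this]
    exact mul_nonpos_of_nonpos_of_nonneg (by linarith) hW0.le
  have anti : AntitoneOn (fun ρ => N ρ * W ρ) (Set.Ici 1) := by
    refine antitoneOn_of_deriv_nonpos (convex_Ici 1) ?_ ?_ ?_
    · intro t ht
      exact (dM t (one_pos.trans_le ht)).continuousAt.continuousWithinAt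
    · intro t ht
      rw [interior_Ici] at ht
      exact (dM t (one_pos.trans ht)).differentiableAt.differentiableWithinAt
    · intro t ht
      rw [interior_Ici] at ht
      rw [(dM t (one_pos.trans ht)).deriv]
      exact hbound t (one_pos.trans ht)
  have h1 := anti (Set.mem_Ici.2 le_rfl) (Set.mem_Ici.2 hρ) hρ
  have hN1 : 0 ≤ N 1 := by positivity
  have hNρ : 0 ≤ N ρ := by positivity
  have hW1 : W 1 ≤ Real.exp |k| := Real.exp_le_exp.2 (by linarith)
  have hWρ : Real.exp (-(4 * ε.re * ρ)) ≤ W ρ := Real.exp_le_exp.2 (by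
    have : 0 ≤ |k| * ρ⁻¹ := by positivity
    linarith)
  have h2 : N ρ * Real.exp (-(4 * ε.re * ρ)) ≤ N 1 * Real.exp |k| :=
    (mul_le_mul_of_nonneg_left hWρ hNρ).trans (h1.trans (mul_le_mul_of_nonneg_left hW1 hN1))
  rw [Real.exp_neg, ← div_eq_mul_inv, div_le_iff₀ (Real.exp_pos _)] at h2
  exact h2

theorem hasDerivAt_besselSeries_ray {α : ℝ} (hα : -1 < α) (ε : ℂ) (ρ : ℝ) :
    HasDerivAt (fun ρ : ℝ => besselSeries α ((ρ * ε) ^ 2))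
      (2 * ρ * ε ^ 2 * besselSeries (α + 1) ((ρ * ε) ^ 2)) ρ := by
  have h1 : HasDerivAt (fun ρ : ℝ => ((ρ : ℂ) * ε) ^ 2) (2 * ρ * ε ^ 2) ρ := by
    have := ((Complex.ofRealCLM.hasDerivAt (x := ρ)).mul_const ε).pow 2
    refine this.congr_deriv ?_
    simp
    ring
  refine ((hasDerivAt_besselSeries hα _).comp ρ h1).congr_deriv ?_
  ring

/-- Along the ray through `s`, `f(ρ) = ρ^a E((ρε)²)` with `a = α + 1/2` satisfies `f'' = (4ε² +
a(a-1)/ρ²) f`: this power removes the first-order term. The combinations `f' ± 2εf` diagonalize the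
leading part, and compactness bounds their values at `ρ = 1` uniformly in the direction `ε`. -/
theorem exists_norm_besselSeries_le_of_one_le {α : ℝ} (hα : -1 < α) :
    ∃ C : ℝ, ∀ s : ℂ, 1 ≤ ‖s‖ → 0 ≤ s.re →
      ‖besselSeries α (s ^ 2)‖ ≤ C * ‖s‖ ^ (-(α + 1 / 2)) * Real.exp (2 * s.re) := by
  have hα' : -1 < α + 1 := by linarith
  obtain ⟨M₀, hM₀⟩ := (isCompact_closedBall (0 : ℂ) 1).exists_bound_of_continuousOn
    (differentiable_besselSeries hα).continuous.continuousOn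
  obtain ⟨M₁, hM₁⟩ := (isCompact_closedBall (0 : ℂ) 1).exists_bound_of_continuousOn
    (differentiable_besselSeries hα').continuous.continuousOn
  set a : ℝ := α + 1 / 2 with ha
  set B : ℝ := 2 * M₁ + |a| * M₀ + 2 * M₀ with hB
  refine ⟨Real.sqrt (2 * B ^ 2 * Real.exp |a * (a - 1)|), fun s hs hsre => ?_⟩
  set r : ℝ := ‖s‖ with hr
  have hr0 : 0 < r := by linarith
  set ε : ℂ := s / r with hε
  have hrC : (r : ℂ) ≠ 0 := by exact_mod_cast hr0.ne'
  have hsε : (r : ℂ) * ε = s := by rw [hε]; field_simp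
  have hε1 : ‖ε‖ = 1 := by
    rw [hε, norm_div, Complex.norm_real, Real.norm_of_nonneg hr0.le, ← hr, div_self hr0.ne']
  have hεre : ε.re = s.re / r := by rw [hε, Complex.div_ofReal_re]
  set E₀ : ℝ → ℂ := fun ρ => besselSeries α ((ρ * ε) ^ 2) with hE₀
  set E₁ : ℝ → ℂ := fun ρ => besselSeries (α + 1) ((ρ * ε) ^ 2) with hE₁
  set f : ℝ → ℂ := fun ρ => ((ρ ^ a : ℝ) : ℂ) * E₀ ρ with hf
  set g : ℝ → ℂ := fun ρ => ((a * ρ ^ (a - 1) : ℝ) : ℂ) * E₀ ρ +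
    ((ρ ^ a : ℝ) : ℂ) * (2 * ρ * ε ^ 2 * E₁ ρ) with hg
  have dpow : ∀ (b : ℝ), ∀ ρ > 0, HasDerivAt (fun ρ : ℝ => ((ρ ^ b : ℝ) : ℂ))
      ((b * ρ ^ (b - 1) : ℝ) : ℂ) ρ := fun b ρ h0 =>
    (Real.hasDerivAt_rpow_const (Or.inl h0.ne')).ofReal_comp
  have df : ∀ ρ > 0, HasDerivAt f (g ρ) ρ := fun ρ h0 =>
    (dpow a ρ h0).mul (hasDerivAt_besselSeries_ray hα ε ρ)
  have dg : ∀ ρ > 0, HasDerivAt g (4 * ε ^ 2 * f ρ + ((a * (a - 1) / ρ ^ 2 : ℝ) : ℂ) * f ρ) ρ := by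
    intro ρ h0
    have h1 := ((dpow (a - 1) ρ h0).const_mul (a : ℂ)).mul (hasDerivAt_besselSeries_ray hα ε ρ)
    have h2 : HasDerivAt (fun ρ : ℝ => 2 * (ρ : ℂ) * ε ^ 2) (2 * ε ^ 2) ρ := by
      have := ((Complex.ofRealCLM.hasDerivAt (x := ρ)).const_mul 2).mul_const (ε ^ 2)
      simpa using this
    have h3 := (dpow a ρ h0).mul (h2.mul (hasDerivAt_besselSeries_ray hα' ε ρ))
    have h4 := h1.add h3
    have hrec := besselSeries_recurrence hα ((ρ * ε) ^ 2)
    have p1 : ρ ^ (a - 1) = ρ ^ a / ρ := by rw [Real.rpow_sub h0, Real.rpow_one]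
    have p2 : ρ ^ (a - 1 - 1) = ρ ^ a / ρ ^ 2 := by
      rw [Real.rpow_sub h0, p1, Real.rpow_one]; field_simp
    have hρC : (ρ : ℂ) ≠ 0 := by exact_mod_cast h0.ne'
    have haC : (a : ℂ) = α + 1 / 2 := by rw [ha]; push_cast; ring
    refine (h4.congr_deriv ?_).congr_of_eventuallyEq (Filter.Eventually.of_forall fun t => ?_)
    · simp only [hf, hE₀, p1, p2, ← hrec, Pi.mul_apply]
      push_cast
      field_simp
      rw [haC]
      ring
    · simp only [hg, hE₀, hE₁, Pi.add_apply, Pi.mul_apply]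
      push_cast
      ring
  have key := norm_sq_add_norm_sq_le_of_hasDerivAt (u := fun ρ => g ρ + 2 * ε * f ρ)
    (v := fun ρ => g ρ - 2 * ε * f ρ) (h := f) hε1 (by rw [hεre]; positivity) (a * (a - 1))
    (fun ρ h0 => ((dg ρ h0).add ((df ρ h0).const_mul (2 * ε))).congr_deriv (by ring))
    (fun ρ h0 => ((dg ρ h0).sub ((df ρ h0).const_mul (2 * ε))).congr_deriv (by ring))
    (fun ρ _ => by ring) hs
  have hmem : ε ^ 2 ∈ Metric.closedBall (0 : ℂ) 1 := by simp [hε1]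
  have hf1 : ‖f 1‖ ≤ M₀ := by simpa [hf, hE₀] using hM₀ _ hmem
  have hg1 : ‖g 1‖ ≤ 2 * M₁ + |a| * M₀ := by
    have e : g 1 = a * besselSeries α (ε ^ 2) + 2 * ε ^ 2 * besselSeries (α + 1) (ε ^ 2) := by
      simp [hg, hE₀, hE₁]
    rw [e]
    refine (norm_add_le _ _).trans ?_
    rw [norm_mul, norm_mul, norm_mul, norm_pow, hε1, Complex.norm_real, Real.norm_eq_abs]
    have i1 := mul_le_mul_of_nonneg_left (hM₀ _ hmem) (abs_nonneg a)
    have i2 := hM₁ _ hmem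
    norm_num
    linarith
  have h2f : ‖2 * ε * f 1‖ ≤ 2 * M₀ := by
    rw [norm_mul, norm_mul, hε1]; norm_num; exact hf1
  have hu1 : ‖g 1 + 2 * ε * f 1‖ ≤ B := (norm_add_le _ _).trans (by linarith)
  have hv1 : ‖g 1 - 2 * ε * f 1‖ ≤ B := (norm_sub_le _ _).trans (by linarith)
  have hN1 : ‖g 1 + 2 * ε * f 1‖ ^ 2 + ‖g 1 - 2 * ε * f 1‖ ^ 2 ≤ 2 * B ^ 2 := by
    have i1 := pow_le_pow_left₀ (norm_nonneg _) hu1 2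
    have i2 := pow_le_pow_left₀ (norm_nonneg _) hv1 2
    linarith
  have hfr : ‖f r‖ ^ 2 ≤ ‖g r + 2 * ε * f r‖ ^ 2 + ‖g r - 2 * ε * f r‖ ^ 2 := by
    have e := parallelogram_law_with_norm ℝ (g r) (2 * ε * f r)
    have e2 : ‖2 * ε * f r‖ = 2 * ‖f r‖ := by rw [norm_mul, norm_mul, hε1]; norm_num
    rw [e2] at e
    nlinarith [norm_nonneg (f r), norm_nonneg (g r)]
  have hfin : ‖f r‖ ^ 2 ≤ 2 * B ^ 2 * Real.exp |a * (a - 1)| * Real.exp (2 * s.re) ^ 2 := by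
    refine hfr.trans (key.trans ?_)
    have e : Real.exp (4 * ε.re * r) = Real.exp (2 * s.re) ^ 2 := by
      rw [← Real.exp_nat_mul, hεre]; congr 1; push_cast; field_simp; ring
    rw [e]
    gcongr
  have hf' : ‖f r‖ ≤ Real.sqrt (2 * B ^ 2 * Real.exp |a * (a - 1)|) * Real.exp (2 * s.re) := by
    refine abs_le_of_sq_le_sq' ?_ (by positivity) |>.2
    rw [mul_pow, Real.sq_sqrt (by positivity)]
    exact hfin
  have hfe : ‖f r‖ = r ^ a * ‖besselSeries α (s ^ 2)‖ := by
    simp only [hf, hE₀]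
    rw [norm_mul, Complex.norm_real, Real.norm_of_nonneg (by positivity), hsε]
  rw [hfe] at hf'
  rw [Real.rpow_neg hr0.le]
  have hra : 0 < r ^ a := by positivity
  rw [mul_comm, ← le_div_iff₀ hra] at hf'
  refine hf'.trans (le_of_eq ?_)
  field_simp

/-- Evenness of `s ↦ s²` handles the left half-plane, and compactness the unit disc. -/
theorem exists_norm_besselSeries_le {α : ℝ} (hα : -1 < α) :
    ∃ C : ℝ, 0 ≤ C ∧ ∀ s : ℂ,
      ‖besselSeries α (s ^ 2)‖ ≤ C * (1 + ‖s‖) ^ (-(α + 1 / 2)) * Real.exp (2 * |s.re|) := by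
  obtain ⟨C, hC⟩ := exists_norm_besselSeries_le_of_one_le hα
  obtain ⟨M, hM⟩ := (isCompact_closedBall (0 : ℂ) 1).exists_bound_of_continuousOn
    (differentiable_besselSeries hα).continuous.continuousOn
  set a : ℝ := α + 1 / 2
  have hM0 : 0 ≤ M := (norm_nonneg _).trans (hM 0 (by simp))
  refine ⟨(|C| + M) * 2 ^ |a|, by positivity, fun s => ?_⟩
  have hs0 := norm_nonneg s
  rcases le_total 1 ‖s‖ with h | h
  · have key : ‖besselSeries α (s ^ 2)‖ ≤ C * ‖s‖ ^ (-a) * Real.exp (2 * |s.re|) := by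
      rcases le_total 0 s.re with h0 | h0
      · rw [abs_of_nonneg h0]; exact hC s h h0
      · have := hC (-s) (by simpa using h) (by simpa using h0)
        rw [abs_of_nonpos h0]; simpa using this
    have hpos : 0 < ‖s‖ := by linarith
    have e : ‖s‖ ^ (-a) ≤ 2 ^ |a| * (1 + ‖s‖) ^ (-a) := by
      have := rpow_le_rpow_abs (m := 2) (t := ‖s‖ / (1 + ‖s‖)) (by positivity)
        (by rw [le_div_iff₀ (by positivity)]; linarith)
        (by rw [div_le_iff₀ (by positivity)]; linarith) (-a)
      rwa [abs_neg, Real.div_rpow hs0 (by positivity), div_le_iff₀ (by positivity)] at this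
    calc ‖besselSeries α (s ^ 2)‖ ≤ C * ‖s‖ ^ (-a) * Real.exp (2 * |s.re|) := key
      _ ≤ (|C| + M) * (2 ^ |a| * (1 + ‖s‖) ^ (-a)) * Real.exp (2 * |s.re|) := by
        gcongr
        linarith [le_abs_self C]
      _ = _ := by ring
  · have h1 : ‖besselSeries α (s ^ 2)‖ ≤ M := hM _ (by
      simp only [mem_closedBall_zero_iff, norm_pow]
      exact pow_le_one₀ hs0 h)
    have e : 1 ≤ 2 ^ |a| * (1 + ‖s‖) ^ (-a) := by
      have := rpow_le_rpow_abs (m := 2) (t := 1 + ‖s‖) (by positivity)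
        (by norm_num; linarith) (by linarith) a
      rw [Real.rpow_neg (by positivity), ← div_eq_mul_inv, le_div_iff₀ (by positivity)]
      linarith
    have e2 : 1 ≤ Real.exp (2 * |s.re|) := Real.one_le_exp (by positivity)
    calc ‖besselSeries α (s ^ 2)‖ ≤ M * 1 * 1 := by linarith
      _ ≤ (|C| + M) * (2 ^ |a| * (1 + ‖s‖) ^ (-a)) * Real.exp (2 * |s.re|) := by
        gcongr
        linarith [abs_nonneg C]
      _ = _ := by ring

theorem exists_norm_hilleHardyComplex_le {α : ℝ} (hα : -1 < α) {x y : ℝ} (hx : 0 < x)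
    (hy : 0 < y) :
    ∃ C : ℝ, 0 ≤ C ∧ ∀ z : ℂ, ‖z‖ < 1 →
      ‖hilleHardyComplex α x y z‖ ≤ C * ‖1 - z‖ ^ (-(1 / 2) : ℝ) := by
  obtain ⟨C, hC0, hC⟩ := exists_norm_besselSeries_le hα
  set τ : ℝ := Real.sqrt (x * y) with hτ
  have hτ0 : 0 < τ := Real.sqrt_pos.2 (by positivity)
  have hτ2 : τ ^ 2 = x * y := Real.sq_sqrt (by positivity)
  have hτxy : 2 * τ ≤ x + y := by nlinarith [sq_nonneg (x - y)]
  set a : ℝ := α + 1 / 2 with ha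
  -- Chosen so that `D = |1-z| + τ|s₀|` below stays in `[m⁻¹, m]`; then `D ^ (-a)` is bounded
  -- whatever the sign of `a`.
  set m : ℝ := 2 + τ + τ⁻¹ with hm
  have hτi : 0 < τ⁻¹ := by positivity
  have hm0 : 0 < m := by positivity
  refine ⟨C * m ^ |a| * Real.exp (2 * (x + y)), by positivity, fun z hz => ?_⟩
  have h1z := one_sub_ne_zero hz
  have hn : 0 < ‖1 - z‖ := norm_pos_iff.2 h1z
  -- The root in the right half-plane keeps `1 + s₀` away from 0.
  obtain ⟨s₀, hs₀, hs₀re⟩ : ∃ s : ℂ, s ^ 2 = z ∧ 0 ≤ s.re := by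
    obtain ⟨s, hs⟩ := IsAlgClosed.exists_pow_nat_eq z two_pos
    rcases le_total 0 s.re with h | h
    · exact ⟨s, hs, h⟩
    · exact ⟨-s, by rw [neg_sq, hs], by simpa using h⟩
  have hσ0 := norm_nonneg s₀
  have hσz : ‖s₀‖ ^ 2 = ‖z‖ := by rw [← norm_pow, hs₀]
  have hσ1 : ‖s₀‖ < 1 := by nlinarith
  set s : ℂ := τ * (s₀ / (1 - z)) with hs
  have hs2 : z * x * y / (1 - z) ^ 2 = s ^ 2 := by
    have : ((τ : ℂ)) ^ 2 = x * y := by exact_mod_cast hτ2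
    rw [hs, mul_pow, div_pow, hs₀, this]; ring
  set X : ℝ := (z / (1 - z)).re with hX
  have hX1 : -(1 / 2) ≤ X := by
    have h := div_one_sub_add_conj hz
    have : 0 ≤ (1 - ‖z‖ ^ 2) / ‖1 - z‖ ^ 2 :=
      div_nonneg (by nlinarith [norm_nonneg z]) (by positivity)
    linarith
  have h1s : 1 ≤ ‖1 + s₀‖ := by
    have := Complex.re_le_norm (1 + s₀)
    simp only [Complex.add_re, Complex.one_re] at this
    linarith
  have h1s' : 1 + s₀ ≠ 0 := norm_pos_iff.1 (by linarith)
  have hsre : |s.re| ≤ τ * (|X| + 1) := by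
    -- Since `1 - z = (1 - s₀)(1 + s₀)`, the real part of the Bessel argument differs from `τX` by a
    -- bounded amount; `exp(-(x+y)X)` can then absorb its growth, because `X ≥ -1/2`.
    have e : s₀ / (1 - z) = z / (1 - z) + s₀ / (1 + s₀) := by
      rw [← hs₀] at h1z ⊢
      field_simp
      ring
    have h2 : |(s₀ / (1 + s₀)).re| ≤ 1 := by
      refine (Complex.abs_re_le_norm _).trans ?_
      rw [norm_div, div_le_one (by linarith)]
      linarith
    rw [hs, e, Complex.re_ofReal_mul, abs_mul, abs_of_pos hτ0, Complex.add_re]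
    gcongr
    exact (abs_add_le _ _).trans (by linarith)
  have hexp : Real.exp (-((x + y) * X)) * Real.exp (2 * |s.re|) ≤ Real.exp (2 * (x + y)) := by
    rw [← Real.exp_add, Real.exp_le_exp]
    have h3 : 2 * |s.re| ≤ (x + y) * (|X| + 1) := by nlinarith [abs_nonneg X]
    have h4 : |X| - X ≤ 1 := by
      rcases abs_cases X with ⟨h, _⟩ | ⟨h, _⟩ <;> linarith
    nlinarith
  set D : ℝ := ‖1 - z‖ + τ * ‖s₀‖ with hD
  have hD0 : 0 < D := by positivity
  have hDs : 1 + ‖s‖ = D / ‖1 - z‖ := by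
    rw [hs, norm_mul, norm_div, Complex.norm_real, Real.norm_of_nonneg hτ0.le, hD]
    field_simp
  have hlow : 1 - ‖s₀‖ ≤ ‖1 - z‖ := by
    have := norm_sub_norm_le (1 : ℂ) z
    rw [norm_one] at this
    nlinarith
  have hup : ‖1 - z‖ ≤ 2 := by
    have := norm_sub_le (1 : ℂ) z
    rw [norm_one] at this
    linarith
  have hDm : D ^ (-a) ≤ m ^ |a| := by
    rw [← abs_neg]
    refine rpow_le_rpow_abs hD0 ?_ (by nlinarith) (-a)
    rw [inv_le_iff_one_le_mul₀ hm0]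
    have h5 : τ⁻¹ * τ = 1 := inv_mul_cancel₀ hτ0.ne'
    have h6 : 1 - ‖s₀‖ + τ * ‖s₀‖ ≤ D := by linarith
    have h7 : 0 ≤ (2 + τ + τ⁻¹) * (D - (1 - ‖s₀‖ + τ * ‖s₀‖)) :=
      mul_nonneg hm0.le (by linarith)
    have h8 : (2 + τ + τ⁻¹) * (1 - ‖s₀‖ + τ * ‖s₀‖) =
      (2 + τ + τ⁻¹) * (1 - ‖s₀‖) + (2 * τ + τ * τ) * ‖s₀‖ + (τ⁻¹ * τ) * ‖s₀‖ := by ring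
    rw [h5] at h8
    have h9 : 0 ≤ (τ + τ⁻¹) * (1 - ‖s₀‖) := mul_nonneg (by positivity) (by linarith)
    have h10 : 0 ≤ (2 * τ + τ * τ) * ‖s₀‖ := by positivity
    rw [hm]
    nlinarith
  have e3 : (-(z * (x + y)) / (1 - z)).re = -((x + y) * X) := by
    have : -(z * (x + y)) / (1 - z) = ((-(x + y) : ℝ) : ℂ) * (z / (1 - z)) := by
      push_cast; ring
    rw [this, Complex.re_ofReal_mul]; ring
  rw [hilleHardyComplex_eq_besselSeries α hx hy hz, norm_mul, norm_mul, ← Complex.ofReal_neg,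
    Complex.norm_cpow_real, Complex.norm_exp, e3, hs2]
  calc ‖1 - z‖ ^ (-(α + 1)) * Real.exp (-((x + y) * X)) * ‖besselSeries α (s ^ 2)‖
      ≤ ‖1 - z‖ ^ (-(α + 1)) * Real.exp (-((x + y) * X)) *
          (C * (1 + ‖s‖) ^ (-a) * Real.exp (2 * |s.re|)) := by
        gcongr
        exact hC s
    _ = C * (1 + ‖s‖) ^ (-a) * ‖1 - z‖ ^ (-(α + 1)) *
          (Real.exp (-((x + y) * X)) * Real.exp (2 * |s.re|)) := by ring
    _ ≤ C * (1 + ‖s‖) ^ (-a) * ‖1 - z‖ ^ (-(α + 1)) * Real.exp (2 * (x + y)) := by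
        gcongr
    _ = C * D ^ (-a) * Real.exp (2 * (x + y)) * ‖1 - z‖ ^ (-(1 / 2) : ℝ) := by
        have e4 : (-(1 / 2) : ℝ) = a + -(α + 1) := by rw [ha]; ring
        rw [hDs, Real.div_rpow hD0.le hn.le, e4, Real.rpow_add hn, Real.rpow_neg hn.le a]
        field_simp
    _ ≤ C * m ^ |a| * Real.exp (2 * (x + y)) * ‖1 - z‖ ^ (-(1 / 2) : ℝ) := by
        gcongr

/-! ### Polar coordinates and weighted moments on the disc. -/

theorem polarCoord_symm_eq_circleMap (p : ℝ × ℝ) :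
    Complex.polarCoord.symm p = circleMap 0 p.1 p.2 := by
  rw [Complex.polarCoord_symm_apply, circleMap_zero, Complex.exp_mul_I]
  push_cast
  rfl

theorem integral_ball_eq_integral_circleMap {g : ℂ → ℂ}
    (hg : Measurable ((Metric.ball (0 : ℂ) 1).indicator g)) {H Θ : ℝ → ℝ}
    (hH : IntegrableOn H (Set.Ioo 0 1)) (hΘ : IntegrableOn Θ (Set.Ioo (-Real.pi) Real.pi))
    (hb : ∀ r ∈ Set.Ioo (0 : ℝ) 1, ∀ θ ∈ Set.Ioo (-Real.pi) Real.pi, θ ≠ 0 →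
      r * ‖g (circleMap 0 r θ)‖ ≤ H r * Θ θ) :
    IntegrableOn g (Metric.ball 0 1) ∧
      ∫ z in Metric.ball (0 : ℂ) 1, g z =
        ∫ r in Set.Ioo (0 : ℝ) 1, ∫ θ in (-Real.pi)..Real.pi, (r : ℂ) * g (circleMap 0 r θ) := by
  set G : ℂ → ℂ := (Metric.ball (0 : ℂ) 1).indicator g with hG
  set S : Set (ℝ × ℝ) := Set.Ioo 0 1 ×ˢ Set.Ioo (-Real.pi) Real.pi with hS
  set T : Set (ℝ × ℝ) := polarCoord.target with hT
  have hTdef : T = Set.Ioi 0 ×ˢ Set.Ioo (-Real.pi) Real.pi := rfl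
  have hST : S ⊆ T := by
    rw [hTdef, hS]; exact Set.prod_mono Set.Ioo_subset_Ioi_self subset_rfl
  have hSm : MeasurableSet S := measurableSet_Ioo.prod measurableSet_Ioo
  have hTm : MeasurableSet T := measurableSet_Ioi.prod measurableSet_Ioo
  set Q : ℝ × ℝ → ℂ := fun p => p.1 • G (Complex.polarCoord.symm p) with hQ
  have hin : ∀ p ∈ S, Q p = (p.1 : ℂ) * g (circleMap 0 p.1 p.2) := by
    intro p hp
    have h1 := hp.1
    simp only [hQ, hG]
    rw [polarCoord_symm_eq_circleMap, Set.indicator_of_mem, Complex.real_smul]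
    simp [abs_of_pos h1.1, h1.2]
  have hout : ∀ p ∈ T \ S, Q p = 0 := by
    intro p hp
    have h0 : 0 < p.1 := (hTdef ▸ hp.1).1
    have h1 : 1 ≤ p.1 := by
      by_contra h
      exact hp.2 ⟨⟨h0, not_le.1 h⟩, (hTdef ▸ hp.1).2⟩
    simp only [hQ, hG]
    rw [polarCoord_symm_eq_circleMap, Set.indicator_of_notMem, smul_zero]
    simp [abs_of_pos h0, h1]
  have hsymm : Continuous fun p : ℝ × ℝ => Complex.polarCoord.symm p := by
    simp only [polarCoord_symm_eq_circleMap, circleMap_zero]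
    fun_prop
  have hQm : Measurable Q := by
    have h1 : Measurable fun p : ℝ × ℝ => G (Complex.polarCoord.symm p) :=
      hg.comp hsymm.measurable
    exact measurable_fst.smul h1
  have hvol : (volume : Measure (ℝ × ℝ)).restrict S =
      (volume.restrict (Set.Ioo (0 : ℝ) 1)).prod
        (volume.restrict (Set.Ioo (-Real.pi) Real.pi)) := by
    rw [Measure.prod_restrict, Measure.volume_eq_prod]
  -- The ray `θ = 0` is null and must be dropped: the majorant `(|θ|/π)^(-1/2)` used later takes the
  -- default value 0 there.
  have hne : ∀ᵐ p ∂(volume : Measure (ℝ × ℝ)), p.2 ≠ 0 := by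
    have : {p : ℝ × ℝ | ¬ p.2 ≠ 0} = Set.univ ×ˢ {(0 : ℝ)} := by
      ext p; simp
    rw [ae_iff, this, Measure.volume_eq_prod, Measure.prod_prod]
    simp
  have hQS : IntegrableOn Q S := by
    have hmaj : Integrable (fun p : ℝ × ℝ => H p.1 * Θ p.2) (volume.restrict S) := by
      rw [hvol]; exact Integrable.mul_prod hH hΘ
    refine hmaj.mono' hQm.aestronglyMeasurable ?_
    rw [ae_restrict_iff' hSm]
    filter_upwards [hne] with p hp hpS
    rw [hin p hpS, norm_mul, Complex.norm_real, Real.norm_of_nonneg hpS.1.1.le]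
    exact hb p.1 hpS.1 p.2 hpS.2 hp
  have hQT : IntegrableOn Q T := hQS.of_forall_sdiff_eq_zero hTm hout
  have hGint : Integrable G := by
    refine ⟨hg.aestronglyMeasurable, ?_⟩
    rw [HasFiniteIntegral, ← Complex.lintegral_comp_polarCoord_symm]
    refine lt_of_le_of_lt (setLIntegral_mono' hTm fun p hp => ?_) hQT.2
    have h0 : 0 < p.1 := (show p ∈ Set.Ioi 0 ×ˢ Set.Ioo (-Real.pi) Real.pi from hp).1
    simp only [hQ]
    rw [enorm_smul, Real.enorm_of_nonneg h0.le, smul_eq_mul]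
  refine ⟨(integrable_indicator_iff Metric.isOpen_ball.measurableSet).1 hGint, ?_⟩
  rw [← integral_indicator Metric.isOpen_ball.measurableSet, ← Complex.integral_comp_polarCoord_symm]
  change ∫ p in T, Q p = _
  rw [setIntegral_eq_of_subset_of_forall_sdiff_eq_zero hTm hST hout,
    setIntegral_congr_fun hSm hin]
  have hQS' : IntegrableOn (fun p : ℝ × ℝ => (p.1 : ℂ) * g (circleMap 0 p.1 p.2)) S :=
    (integrableOn_congr_fun hin hSm).1 hQS
  rw [Measure.volume_eq_prod] at hQS' ⊢
  rw [setIntegral_prod _ hQS']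
  refine setIntegral_congr_fun measurableSet_Ioo fun r _ => ?_
  simp only
  rw [intervalIntegral.integral_of_le (by linarith [Real.pi_pos]), integral_Ioc_eq_integral_Ioo]

/-- For `|θ| ≤ π/2` the distance from 1 to the line through 0 in direction `θ` is `sin |θ|`, and
Jordan's inequality applies; for larger angles the cosine is nonpositive and the distance is at
least 1. -/
theorem abs_div_pi_le_norm_one_sub_circleMap {r θ : ℝ} (hr : 0 ≤ r) (hθ : |θ| ≤ Real.pi) :
    |θ| / Real.pi ≤ ‖1 - circleMap 0 r θ‖ := by
  have hsq : ‖1 - circleMap 0 r θ‖ ^ 2 = (1 - r * Real.cos |θ|) ^ 2 + (r * Real.sin |θ|) ^ 2 := by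
    have hs : Real.sin |θ| ^ 2 = Real.sin θ ^ 2 := by
      rcases abs_cases θ with ⟨h, _⟩ | ⟨h, _⟩
      · rw [h]
      · rw [h, Real.sin_neg, neg_sq]
    rw [← Complex.normSq_eq_norm_sq, Complex.normSq_apply, circleMap_zero, Real.cos_abs, mul_pow,
      hs, Complex.exp_mul_I]
    simp [Complex.cos_ofReal_re, Complex.sin_ofReal_re]
    ring
  have hsc := Real.sin_sq_add_cos_sq |θ|
  have hπ := Real.pi_pos
  have h0 := abs_nonneg θ
  refine abs_le_of_sq_le_sq' ?_ (norm_nonneg _) |>.2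
  rw [hsq]
  rcases le_total |θ| (Real.pi / 2) with h | h
  · have h1 := Real.mul_le_sin h0 h
    have h2 : |θ| / Real.pi ≤ Real.sin |θ| := by
      refine le_trans ?_ h1
      rw [div_le_iff₀ hπ]
      field_simp
      linarith
    have h3 : (|θ| / Real.pi) ^ 2 ≤ Real.sin |θ| ^ 2 := pow_le_pow_left₀ (by positivity) h2 2
    nlinarith [sq_nonneg (r - Real.cos |θ|)]
  · have h1 : Real.cos |θ| ≤ 0 := Real.cos_nonpos_of_pi_div_two_le_of_le h (by linarith)
    have h2 : (|θ| / Real.pi) ^ 2 ≤ 1 := pow_le_one₀ (by positivity) (by rwa [div_le_one hπ])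
    have h3 : 0 ≤ r * -Real.cos |θ| := mul_nonneg hr (by linarith)
    nlinarith [sq_nonneg (r * Real.cos |θ|), sq_nonneg (r * Real.sin |θ|)]

theorem integrableOn_abs_div_pi_rpow :
    IntegrableOn (fun θ : ℝ => (|θ| / Real.pi) ^ (-(1 / 2) : ℝ)) (Set.Ioo (-Real.pi) Real.pi) := by
  have hπ := Real.pi_pos
  have h : IntervalIntegrable (fun θ : ℝ => (|θ| / Real.pi) ^ (-(1 / 2) : ℝ)) volume
      (-Real.pi) Real.pi := by
    refine intervalIntegrable_of_even (fun x => by rw [abs_neg]) (fun x hx => ?_)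
    have h1 := (intervalIntegral.intervalIntegrable_rpow' (a := 0) (b := x)
      (r := (-(1 / 2) : ℝ)) (by norm_num)).div_const (Real.pi ^ (-(1 / 2) : ℝ))
    refine h1.congr ?_
    intro t ht
    rw [Set.uIoc_of_le hx.le] at ht
    simp only
    rw [abs_of_pos ht.1, Real.div_rpow ht.1.le hπ.le]
  rw [intervalIntegrable_iff_integrableOn_Ioo_of_le (by linarith)] at h
  exact h

/-- The Beta integral under `t = r²`, with the integrand cut off at 1 so that the power substitution
on the half-line applies. -/
theorem integral_mul_sq_rpow_mul_one_sub_sq_rpow {b η : ℝ} (hb : 0 < b) (hη : 0 < η) :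
    IntegrableOn (fun r : ℝ => r * ((r ^ 2) ^ (b - 1) * (1 - r ^ 2) ^ (η - 1))) (Set.Ioo 0 1) ∧
    ∫ r in Set.Ioo (0 : ℝ) 1, r * ((r ^ 2) ^ (b - 1) * (1 - r ^ 2) ^ (η - 1)) =
      Real.Gamma b * Real.Gamma η / Real.Gamma (b + η) / 2 := by
  set g : ℝ → ℝ := fun t => t ^ (b - 1) * (1 - t) ^ (η - 1) with hg
  have hcast : ∀ t ∈ Set.Ioc (0 : ℝ) 1,
      (t : ℂ) ^ ((b : ℂ) - 1) * (1 - (t : ℂ)) ^ ((η : ℂ) - 1) = ((g t : ℝ) : ℂ) := by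
    intro t ht
    simp only [hg]
    push_cast
    rw [Complex.ofReal_cpow ht.1.le, Complex.ofReal_cpow (by linarith [ht.2])]
    push_cast
    rfl
  have hconv : IntegrableOn g (Set.Ioo 0 1) := by
    have h := Complex.betaIntegral_convergent (u := b) (v := η) (by simpa) (by simpa)
    rw [intervalIntegrable_iff_integrableOn_Ioc_of_le zero_le_one] at h
    have h' := ((integrableOn_congr_fun hcast measurableSet_Ioc).1 h).re
    exact (h'.congr (Filter.Eventually.of_forall fun x => Complex.ofReal_re _)).mono_measure
      (Measure.restrict_mono Set.Ioo_subset_Ioc_self le_rfl)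
  have hval : ∫ t in Set.Ioo (0 : ℝ) 1, g t = Real.Gamma b * Real.Gamma η / Real.Gamma (b + η) := by
    have h := Complex.betaIntegral_eq_Gamma_mul_div b η (by simpa) (by simpa)
    rw [Complex.betaIntegral, intervalIntegral.integral_of_le zero_le_one,
      setIntegral_congr_fun measurableSet_Ioc hcast, integral_complex_ofReal,
      integral_Ioc_eq_integral_Ioo, ← Complex.ofReal_add, Complex.Gamma_ofReal,
      Complex.Gamma_ofReal, Complex.Gamma_ofReal] at h
    exact_mod_cast h
  set φ : ℝ → ℝ := (Set.Iio 1).indicator g with hφ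
  have hset : Set.Iio (1 : ℝ) ∩ Set.Ioi 0 = Set.Ioo 0 1 := by ext; simp [and_comm]
  have hset' : Set.Ioi (0 : ℝ) ∩ Set.Iio 1 = Set.Ioo 0 1 := by ext; simp
  have hφint : IntegrableOn φ (Set.Ioi 0) := by
    rw [hφ, integrableOn_indicator_iff measurableSet_Iio, hset]; exact hconv
  have hpt : ∀ x ∈ Set.Ioi (0 : ℝ), (2 * x ^ ((2 : ℝ) - 1)) • φ (x ^ (2 : ℝ)) =
      (Set.Iio 1).indicator (fun r => 2 * (r * ((r ^ 2) ^ (b - 1) * (1 - r ^ 2) ^ (η - 1)))) x := by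
    intro x hx
    have hx' : (0 : ℝ) < x := hx
    have e1 : x ^ ((2 : ℝ) - 1) = x := by norm_num
    rw [e1, Real.rpow_two, smul_eq_mul, hφ]
    by_cases h : x < 1
    · rw [Set.indicator_of_mem (by simp; rw [abs_of_pos hx']; exact h),
        Set.indicator_of_mem (by exact h)]
      simp only [hg]; ring
    · rw [Set.indicator_of_notMem (by simp; rw [abs_of_pos hx']; linarith),
        Set.indicator_of_notMem (by exact h), mul_zero]
  constructor
  · have h := (integrableOn_Ioi_comp_rpow_iff φ two_ne_zero).2 hφint
    rw [abs_two, integrableOn_congr_fun hpt measurableSet_Ioi,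
      integrableOn_indicator_iff measurableSet_Iio, hset] at h
    refine (h.const_mul (1 / 2)).congr (Filter.Eventually.of_forall fun r => ?_)
    simp only
    ring
  · have h := integral_comp_rpow_Ioi_of_pos (g := φ) two_pos
    rw [setIntegral_congr_fun measurableSet_Ioi hpt, setIntegral_indicator measurableSet_Iio, hφ,
      setIntegral_indicator measurableSet_Iio, hset', hval, integral_const_mul] at h
    linarith

/-- The angular integrals are Cauchy integrals for the Taylor coefficients, and `θ ↦ -θ` together
with the symmetry of `f` makes them real. Uniqueness of power series makes the coefficients
independent of the radius, so `1/2` serves as reference. -/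
theorem exists_real_coeff_hasSum_and_circle_integral {f : ℂ → ℂ}
    (hd : DifferentiableOn ℂ f (Metric.ball 0 1))
    (hconj : ∀ z, ‖z‖ < 1 → f (conj z) = conj (f z)) :
    ∃ c : ℕ → ℝ, (∀ z, ‖z‖ < 1 → HasSum (fun k => (c k : ℂ) * z ^ k) (f z)) ∧
      ∀ (k : ℕ) (r : ℝ), 0 < r → r < 1 →
        ∫ θ in (-Real.pi)..Real.pi, conj (circleMap 0 r θ) ^ k * f (circleMap 0 r θ) =
          ((2 * Real.pi * c k * r ^ (2 * k) : ℝ) : ℂ) := by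
  set P : ℝ → FormalMultilinearSeries ℂ ℂ ℂ := fun r => cauchyPowerSeries f 0 r with hP
  have hps : ∀ r : ℝ, 0 < r → r < 1 → HasFPowerSeriesOnBall f (P r) 0 (ENNReal.ofReal r) := by
    intro r h0 h1
    have h := DifferentiableOn.hasFPowerSeriesOnBall (R := r.toNNReal) (f := f) (c := 0)
      (hd.mono (Metric.closedBall_subset_ball (by rwa [Real.coe_toNNReal r h0.le])))
      (Real.toNNReal_pos.2 h0)
    rwa [Real.coe_toNNReal r h0.le] at h
  have heq : ∀ r, 0 < r → r < 1 → P r = P (1 / 2) := fun r h0 h1 =>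
    (hps r h0 h1).hasFPowerSeriesAt.eq_formalMultilinearSeries
      (hps (1 / 2) (by norm_num) (by norm_num)).hasFPowerSeriesAt
  set J : ℕ → ℝ → ℂ := fun k r =>
    ∫ θ in (-Real.pi)..Real.pi, conj (circleMap 0 r θ) ^ k * f (circleMap 0 r θ) with hJ
  have hJcoeff : ∀ k r, 0 < r → r < 1 →
      J k r = ((2 * Real.pi * r ^ (2 * k) : ℝ) : ℂ) * (P (1 / 2)).coeff k := by
    intro k r h0 h1
    have hper : Function.Periodic
        (fun θ => conj (circleMap 0 r θ) ^ k * f (circleMap 0 r θ)) (2 * Real.pi) := fun θ => by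
      simp only [periodic_circleMap 0 r θ]
    have hshift := hper.intervalIntegral_add_eq (-Real.pi) 0
    rw [show -Real.pi + 2 * Real.pi = Real.pi by ring, zero_add] at hshift
    have hr : (r : ℂ) ≠ 0 := by exact_mod_cast h0.ne'
    have hpi : (2 * Real.pi * Complex.I : ℂ) ≠ 0 := Complex.two_pi_I_ne_zero
    rw [hJ, ← heq r h0 h1, FormalMultilinearSeries.coeff]
    have hone : (1 : Fin k → ℂ) = fun _ => 1 := rfl
    simp only [hP]
    rw [hshift, hone, cauchyPowerSeries_apply, circleIntegral]
    simp only [sub_zero, smul_eq_mul, deriv_circleMap]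
    rw [← intervalIntegral.integral_const_mul, ← intervalIntegral.integral_const_mul]
    refine intervalIntegral.integral_congr fun θ _ => ?_
    have hne : circleMap 0 r θ ≠ 0 := circleMap_ne_center h0.ne'
    -- On the circle `ζ̄ = r²/ζ`, which turns `ζ̄ᵏ` into the Cauchy factor `ζ⁻ᵏ`.
    have hn : conj (circleMap 0 r θ) = (r : ℂ) ^ 2 / circleMap 0 r θ := by
      rw [eq_div_iff hne, mul_comm, Complex.mul_conj, Complex.normSq_eq_norm_sq]
      simp
    simp only [hn]
    push_cast
    rw [div_pow, div_pow, one_pow, pow_mul]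
    field_simp
  have hJconj : ∀ k r, 0 < r → r < 1 → conj (J k r) = J k r := by
    intro k r h0 h1
    have hneg : ∀ θ, conj (circleMap 0 r θ) = circleMap 0 r (-θ) := by
      intro θ
      simp only [circleMap_zero, map_mul, Complex.conj_ofReal, ← Complex.exp_conj, Complex.conj_I]
      congr 2; push_cast; ring
    have h := intervalIntegral.integral_comp_neg (a := -Real.pi) (b := Real.pi)
      (fun θ => conj (circleMap 0 r θ) ^ k * f (circleMap 0 r θ))
    rw [neg_neg] at h
    simp only [hJ]
    nth_rw 2 [← h]
    rw [intervalIntegral.integral_of_le (by linarith [Real.pi_pos]), ← integral_conj,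
      intervalIntegral.integral_of_le (by linarith [Real.pi_pos])]
    congr 1
    funext θ
    rw [← hneg, hconj _ (by simpa [abs_of_pos h0] using h1), map_mul, map_pow]
  have hreal : ∀ k, (((P (1 / 2)).coeff k).re : ℂ) = (P (1 / 2)).coeff k := by
    intro k
    have h := hJconj k (1 / 2) (by norm_num) (by norm_num)
    rw [hJcoeff k (1 / 2) (by norm_num) (by norm_num), map_mul, Complex.conj_ofReal] at h
    have hpos : (0 : ℝ) < 2 * Real.pi * (1 / 2) ^ (2 * k) := by have := Real.pi_pos; positivity
    exact Complex.conj_eq_iff_re.1 (mul_left_cancel₀ (by exact_mod_cast hpos.ne') h)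
  refine ⟨fun k => ((P (1 / 2)).coeff k).re, fun z hz => ?_, fun k r h0 h1 => ?_⟩
  · obtain ⟨r, hr, hr1⟩ := exists_between hz
    have h0 : 0 < r := (norm_nonneg z).trans_lt hr
    have h := (hps r h0 hr1).hasSum (y := z) (by
      rw [mem_eball_zero_iff]
      rw [← ofReal_norm]
      exact (ENNReal.ofReal_lt_ofReal_iff h0).2 hr)
    rw [heq r h0 hr1, zero_add] at h
    refine h.congr_terms fun k => ?_
    rw [hreal, FormalMultilinearSeries.apply_eq_pow_smul_coeff, smul_eq_mul, mul_comm]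
  · have h := hJcoeff k r h0 h1
    rw [hJ] at h
    simp only at h
    rw [h, ← hreal k]
    push_cast
    ring

theorem integral_ball_bergmanWeight_mul_conj_pow {f : ℂ → ℂ}
    (hd : DifferentiableOn ℂ f (Metric.ball 0 1)) {C : ℝ} (hC0 : 0 ≤ C)
    (hC : ∀ z, ‖z‖ < 1 → ‖f z‖ ≤ C * ‖1 - z‖ ^ (-(1 / 2) : ℝ)) {β η : ℝ} (hβ : 0 < β)
    (hη : 0 < η) (k : ℕ) :
    IntegrableOn (fun p : ℂ => (bergmanWeight β η (‖p‖ ^ 2) : ℂ) * (conj p ^ k * f p))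
      (Metric.ball 0 1) ∧
    ∀ c : ℝ, (∀ r : ℝ, 0 < r → r < 1 →
        ∫ θ in (-Real.pi)..Real.pi, conj (circleMap 0 r θ) ^ k * f (circleMap 0 r θ) =
          ((2 * Real.pi * c * r ^ (2 * k) : ℝ) : ℂ)) →
      ∫ p in Metric.ball (0 : ℂ) 1, (bergmanWeight β η (‖p‖ ^ 2) : ℂ) * (conj p ^ k * f p) =
        ((c * (Real.pi * (Real.Gamma (β + k) * Real.Gamma η / Real.Gamma (β + k + η))) : ℝ) :
          ℂ) := by
  classical
  have hfm : Measurable ((Metric.ball (0 : ℂ) 1).indicator f) := by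
    rw [← Set.piecewise_eq_indicator]
    exact hd.continuousOn.measurable_piecewise continuousOn_const
      Metric.isOpen_ball.measurableSet
  have hgm : Measurable ((Metric.ball (0 : ℂ) 1).indicator
      (fun p : ℂ => (bergmanWeight β η (‖p‖ ^ 2) : ℂ) * (conj p ^ k * f p))) := by
    have e : ((Metric.ball (0 : ℂ) 1).indicator
        (fun p : ℂ => (bergmanWeight β η (‖p‖ ^ 2) : ℂ) * (conj p ^ k * f p))) =
        fun p => (bergmanWeight β η (‖p‖ ^ 2) : ℂ) *
          (conj p ^ k * (Metric.ball (0 : ℂ) 1).indicator f p) := by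
      funext p
      by_cases h : p ∈ Metric.ball (0 : ℂ) 1
      · simp [Set.indicator_of_mem h]
      · simp [Set.indicator_of_notMem h]
    rw [e]
    have hw : Measurable fun p : ℂ => (bergmanWeight β η (‖p‖ ^ 2) : ℂ) := by
      unfold bergmanWeight
      fun_prop
    have hc : Measurable fun p : ℂ => conj p ^ k := by
      exact (Complex.continuous_conj.pow k).measurable
    exact hw.mul (hc.mul hfm)
  obtain ⟨hI, -⟩ := integral_mul_sq_rpow_mul_one_sub_sq_rpow hβ hη
  have key := integral_ball_eq_integral_circleMap hgm (hI.const_mul C)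
    integrableOn_abs_div_pi_rpow (fun r hr θ hθ hθ0 => by
      have hn : ‖circleMap 0 r θ‖ = r := by simp [abs_of_pos hr.1]
      have hw0 : 0 ≤ (r ^ 2) ^ (β - 1) * (1 - r ^ 2) ^ (η - 1) := by
        have : 0 ≤ 1 - r ^ 2 := by nlinarith [hr.1, hr.2]
        positivity
      have hθ' : |θ| ≤ Real.pi := abs_le.2 ⟨hθ.1.le, hθ.2.le⟩
      have hpos : 0 < |θ| / Real.pi := div_pos (abs_pos.2 hθ0) Real.pi_pos
      have h1 : ‖f (circleMap 0 r θ)‖ ≤ C * (|θ| / Real.pi) ^ (-(1 / 2) : ℝ) :=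
        (hC _ (by rw [hn]; exact hr.2)).trans (mul_le_mul_of_nonneg_left
          (Real.rpow_le_rpow_of_nonpos hpos
            (abs_div_pi_le_norm_one_sub_circleMap hr.1.le hθ') (by norm_num)) hC0)
      have h2 : r ^ k ≤ 1 := pow_le_one₀ hr.1.le hr.2.le
      rw [norm_mul, norm_mul, norm_pow, RCLike.norm_conj, Complex.norm_real, hn, bergmanWeight,
        Real.norm_of_nonneg hw0]
      have hr0 := hr.1.le
      calc r * ((r ^ 2) ^ (β - 1) * (1 - r ^ 2) ^ (η - 1) * (r ^ k * ‖f (circleMap 0 r θ)‖))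
          ≤ r * ((r ^ 2) ^ (β - 1) * (1 - r ^ 2) ^ (η - 1) *
              (1 * (C * (|θ| / Real.pi) ^ (-(1 / 2) : ℝ)))) := by gcongr
        _ = _ := by ring)
  refine ⟨key.1, fun c hc => ?_⟩
  obtain ⟨-, hv⟩ := integral_mul_sq_rpow_mul_one_sub_sq_rpow
    (show 0 < β + k by positivity) hη
  have hpt : ∀ r ∈ Set.Ioo (0 : ℝ) 1, ∫ θ in (-Real.pi)..Real.pi, (r : ℂ) *
      ((bergmanWeight β η (‖circleMap 0 r θ‖ ^ 2) : ℂ) *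
        (conj (circleMap 0 r θ) ^ k * f (circleMap 0 r θ))) =
      ((2 * Real.pi * c * (r * ((r ^ 2) ^ (β + k - 1) * (1 - r ^ 2) ^ (η - 1))) : ℝ) : ℂ) := by
    intro r hr
    have hn : ∀ θ, ‖circleMap 0 r θ‖ = r := fun θ => by simp [abs_of_pos hr.1]
    simp only [hn, ← mul_assoc]
    simp only [mul_assoc ((r : ℂ) * _)]
    rw [intervalIntegral.integral_const_mul, hc r hr.1 hr.2, ← Complex.ofReal_mul,
      ← Complex.ofReal_mul]
    congr 1
    have hr2 : 0 < r ^ 2 := pow_pos hr.1 2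
    have e : (r ^ 2) ^ (β + k - 1) = (r ^ 2) ^ (β - 1) * r ^ (2 * k) := by
      rw [show β + k - 1 = β - 1 + k by ring, Real.rpow_add hr2, Real.rpow_natCast, ← pow_mul]
    rw [e, bergmanWeight]
    ring
  rw [key.2, setIntegral_congr_fun measurableSet_Ioo hpt, integral_complex_ofReal,
    integral_const_mul, hv]
  congr 1
  ring

/-! ### Coefficients of the Bergman kernel. -/

theorem gamma_add_nat_eq_ascPochhammer {b : ℝ} (hb : 0 < b) (k : ℕ) :
    Real.Gamma (b + k) = (ascPochhammer ℝ k).eval b * Real.Gamma b := by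
  induction k with
  | zero => simp
  | succ k ih =>
    have : b + k ≠ 0 := by positivity
    rw [Nat.cast_succ, ← add_assoc, Real.Gamma_add_one this, ih, ascPochhammer_succ_eval]
    ring

/-- The coefficients `(1)ₖ (η + β)ₖ / ((β)ₖ k!)` of the Bergman kernel. -/
noncomputable def bergmanCoeff (β η : ℝ) (k : ℕ) : ℝ :=
  (ascPochhammer ℝ k).eval 1 * (ascPochhammer ℝ k).eval (η + β) /
    (ascPochhammer ℝ k).eval β / (k.factorial : ℝ)

theorem bergmanCoeff_eq (β η : ℝ) (k : ℕ) :
    bergmanCoeff β η k = (ascPochhammer ℝ k).eval (η + β) / (ascPochhammer ℝ k).eval β := by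
  have : (k.factorial : ℝ) ≠ 0 := by exact_mod_cast k.factorial_ne_zero
  rw [bergmanCoeff, ascPochhammer_eval_one]
  field_simp

theorem bergmanCoeff_pos {β η : ℝ} (hβ : 0 < β) (hη : 0 < η) (k : ℕ) : 0 < bergmanCoeff β η k := by
  rw [bergmanCoeff_eq]
  exact div_pos (ascPochhammer_pos k _ (by positivity)) (ascPochhammer_pos k _ hβ)

theorem summable_bergmanCoeff_mul_pow {β η : ℝ} (hβ : 0 < β) (hη : 0 < η) {r : ℝ} (hr0 : 0 ≤ r)
    (hr1 : r < 1) : Summable fun k => bergmanCoeff β η k * r ^ k := by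
  -- The ratio test needs nonzero terms, and `r` may be 0.
  obtain ⟨s, hrs, hs1⟩ := exists_between hr1
  have hs0 : 0 < s := hr0.trans_lt hrs
  have hs : Summable fun k => bergmanCoeff β η k * s ^ k := by
    refine summable_of_ratio_test_tendsto_lt_one hs1 (Filter.Eventually.of_forall fun k =>
      (mul_pos (bergmanCoeff_pos hβ hη k) (pow_pos hs0 k)).ne') ?_
    have hratio : ∀ k : ℕ, ‖bergmanCoeff β η (k + 1) * s ^ (k + 1)‖ /
        ‖bergmanCoeff β η k * s ^ k‖ = (1 + η / (β + k)) * s := by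
      intro k
      have h1 := ascPochhammer_pos k β hβ
      have h2 := ascPochhammer_pos k (η + β) (by positivity)
      have h3 : 0 < β + k := by positivity
      rw [Real.norm_of_nonneg (mul_pos (bergmanCoeff_pos hβ hη _) (pow_pos hs0 _)).le,
        Real.norm_of_nonneg (mul_pos (bergmanCoeff_pos hβ hη _) (pow_pos hs0 _)).le,
        bergmanCoeff_eq, bergmanCoeff_eq, ascPochhammer_succ_eval, ascPochhammer_succ_eval]
      field_simp
      ring
    simp only [hratio]
    have h1 : Filter.Tendsto (fun k : ℕ => β + (k : ℝ)) Filter.atTop Filter.atTop :=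
      Filter.tendsto_atTop_add_const_left _ _ tendsto_natCast_atTop_atTop
    have h2 := ((h1.const_div_atTop η).const_add 1).mul_const s
    simpa using h2
  refine Summable.of_nonneg_of_le (fun k => ?_) (fun k => ?_) hs
  · exact mul_nonneg (bergmanCoeff_pos hβ hη k).le (pow_nonneg hr0 k)
  · have := (bergmanCoeff_pos hβ hη k).le
    gcongr

/-- The last factor is the weighted squared norm of `pᵏ`; the kernel coefficients are the
reciprocals of these norms, which is what makes it reproducing. -/
theorem bergmanCoeff_mul_gamma {β η : ℝ} (hβ : 0 < β) (hη : 0 < η) (k : ℕ) :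
    Real.Gamma (β + η) / (Real.pi * Real.Gamma η * Real.Gamma β) * bergmanCoeff β η k *
      (Real.pi * (Real.Gamma (β + k) * Real.Gamma η / Real.Gamma (β + k + η))) = 1 := by
  have hβη : 0 < η + β := by positivity
  have h1 := ascPochhammer_pos k β hβ
  have h2 := ascPochhammer_pos k (η + β) hβη
  have h3 := Real.Gamma_pos_of_pos hβ
  have h4 := Real.Gamma_pos_of_pos hη
  have h5 := Real.Gamma_pos_of_pos hβη
  have h6 := Real.pi_pos
  rw [show β + k + η = η + β + k by ring, add_comm β η, gamma_add_nat_eq_ascPochhammer hβ,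
    gamma_add_nat_eq_ascPochhammer hβη, bergmanCoeff_eq]
  field_simp

/-! ### Slices as copies of the complex plane in the quaternions. -/

theorem slicePoint_eq_liftAux {I : ℍ} (hI : I * I = -1) (z : ℂ) :
    slicePoint I z = Complex.liftAux I hI z := by
  rw [Complex.liftAux_apply]; rfl

theorem star_eq_neg_of_mul_self {I : ℍ} (hI : I * I = -1) : star I = -I := by
  have hnorm : ‖I‖ * ‖I‖ = 1 := by rw [← norm_mul, hI, norm_neg, norm_one]
  have h : star I * I = 1 := by
    rw [Quaternion.star_mul_self, Quaternion.normSq_eq_norm_mul_self, hnorm]; rfl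
  have h2 : star I * (I * I) = I := by rw [← mul_assoc, h, one_mul]
  rw [hI, mul_neg, mul_one] at h2
  rw [← h2, neg_neg]; simp [h2]

theorem star_slicePoint {I : ℍ} (hI : I * I = -1) (z : ℂ) :
    star (slicePoint I z) = slicePoint I (conj z) := by
  simp [slicePoint, star_eq_neg_of_mul_self hI]

theorem norm_slicePoint {I : ℍ} (hI : I * I = -1) (z : ℂ) : ‖slicePoint I z‖ = ‖z‖ := by
  have h : ((‖slicePoint I z‖ * ‖slicePoint I z‖ : ℝ) : ℍ) = ((‖z‖ * ‖z‖ : ℝ) : ℍ) := by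
    rw [← Quaternion.normSq_eq_norm_mul_self, ← Quaternion.self_mul_star, star_slicePoint hI,
      slicePoint_eq_liftAux hI, slicePoint_eq_liftAux hI, ← map_mul, Complex.mul_conj,
      Complex.normSq_eq_norm_sq, ← slicePoint_eq_liftAux hI]
    simp [slicePoint, pow_two]
  have h' : ‖slicePoint I z‖ * ‖slicePoint I z‖ = ‖z‖ * ‖z‖ := Quaternion.coe_injective h
  nlinarith [norm_nonneg z, norm_nonneg (slicePoint I z)]

theorem slicePoint_ofReal (I : ℍ) (t : ℝ) : slicePoint I (t : ℂ) = (t : ℍ) := by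
  simp [slicePoint]

theorem exists_quaternion_mul_self_eq_neg_one : ∃ J : ℍ, J * J = -1 := by
  obtain ⟨J, h1, h2, h3, h4⟩ : ∃ J : ℍ, J.re = 0 ∧ J.imI = 1 ∧ J.imJ = 0 ∧ J.imK = 0 :=
    ⟨QuaternionAlgebra.mk 0 1 0 0, rfl, rfl, rfl, rfl⟩
  refine ⟨J, ?_⟩
  ext <;> simp [h1, h2, h3, h4]

theorem exists_slicePoint_eq (q : ℍ) :
    ∃ (J : ℍ) (z : ℂ), J * J = -1 ∧ ‖z‖ = ‖q‖ ∧ slicePoint J z = q := by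
  suffices h : ∃ (J : ℍ) (z : ℂ), J * J = -1 ∧ slicePoint J z = q by
    obtain ⟨J, z, hJ, hz⟩ := h
    exact ⟨J, z, hJ, by rw [← hz, norm_slicePoint hJ], hz⟩
  by_cases h : q.im = 0
  · obtain ⟨J, hJ⟩ := exists_quaternion_mul_self_eq_neg_one
    refine ⟨J, (q.re : ℂ), hJ, ?_⟩
    rw [slicePoint_ofReal]
    nth_rw 2 [← Quaternion.re_add_im q]
    rw [h, add_zero]
  · have hn : ‖q.im‖ ≠ 0 := norm_ne_zero_iff.2 h
    refine ⟨‖q.im‖⁻¹ • q.im, ⟨q.re, ‖q.im‖⟩, ?_, ?_⟩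
    · rw [smul_mul_smul_comm, ← pow_two q.im, Quaternion.im_sq, Quaternion.normSq_eq_norm_mul_self,
        smul_neg, ← Quaternion.coe_smul, smul_eq_mul, ← mul_inv, inv_mul_cancel₀ (by positivity)]
      simp
    · rw [slicePoint, smul_smul, mul_inv_cancel₀ hn, one_smul]
      exact Quaternion.re_add_im q

/-- The embedding `u + i v ↦ u + I v` as a continuous linear map. -/
noncomputable def slicePointCLM {I : ℍ} (hI : I * I = -1) : ℂ →L[ℝ] ℍ :=
  LinearMap.toContinuousLinearMap (Complex.liftAux I hI).toLinearMap

theorem slicePointCLM_apply {I : ℍ} (hI : I * I = -1) (z : ℂ) :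
    slicePointCLM hI z = slicePoint I z :=
  (slicePoint_eq_liftAux hI z).symm

theorem slicePoint_mul {I : ℍ} (hI : I * I = -1) (z w : ℂ) :
    slicePoint I (z * w) = slicePoint I z * slicePoint I w := by
  simp only [slicePoint_eq_liftAux hI, map_mul]

theorem slicePoint_pow {I : ℍ} (hI : I * I = -1) (z : ℂ) (n : ℕ) :
    slicePoint I (z ^ n) = slicePoint I z ^ n := by
  simp only [slicePoint_eq_liftAux hI, map_pow]

theorem hasSum_bergmanKernel {β η : ℝ} (hβ : 0 < β) (hη : 0 < η) {p q : ℍ} (hp : ‖p‖ < 1)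
    (hq : ‖q‖ < 1) :
    HasSum (fun k => (Real.Gamma (β + η) / (Real.pi * Real.Gamma η * Real.Gamma β) *
      bergmanCoeff β η k) • (q ^ k * star p ^ k)) (star (bergmanKernel β η p q)) := by
  have hs : Summable fun k : ℕ => bergmanCoeff β η k • (p ^ k * star q ^ k) := by
    refine Summable.of_norm_bounded (summable_bergmanCoeff_mul_pow hβ hη (norm_nonneg q) hq)
      fun k => ?_
    have h0 := (bergmanCoeff_pos hβ hη k).le
    have h1 : ‖p‖ ^ k ≤ 1 := pow_le_one₀ (norm_nonneg p) hp.le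
    rw [norm_smul, Real.norm_of_nonneg h0, norm_mul, norm_pow, norm_pow, norm_star]
    calc bergmanCoeff β η k * (‖p‖ ^ k * ‖q‖ ^ k) ≤ bergmanCoeff β η k * (1 * ‖q‖ ^ k) := by gcongr
      _ = _ := by ring
  have h := (hs.hasSum.const_smul
    (Real.Gamma (β + η) / (Real.pi * Real.Gamma η * Real.Gamma β))).star
  refine h.congr_terms fun k => ?_
  rw [smul_smul, Quaternion.star_smul, star_mul, star_pow, star_pow, star_star]

/-! ### The reproducing formula and the theorem. -/

theorem integral_star_bergmanKernel_mul_sliceExtension {f : ℂ → ℂ}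
    (hd : DifferentiableOn ℂ f (Metric.ball 0 1))
    (hconj : ∀ z, ‖z‖ < 1 → f (conj z) = conj (f z)) {C : ℝ} (hC0 : 0 ≤ C)
    (hC : ∀ z, ‖z‖ < 1 → ‖f z‖ ≤ C * ‖1 - z‖ ^ (-(1 / 2) : ℝ)) {β η : ℝ} (hβ : 0 < β)
    (hη : 0 < η) {I : ℍ} (hI : I * I = -1) {q : ℍ} (hq : ‖q‖ < 1) :
    IntegrableOn (fun p : ℂ => bergmanWeight β η (‖slicePoint I p‖ ^ 2) •
        (star (bergmanKernel β η (slicePoint I p) q) * sliceExtension f (slicePoint I p)))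
      (Metric.ball (0 : ℂ) 1) ∧
    sliceExtension f q = ∫ p in Metric.ball (0 : ℂ) 1,
      bergmanWeight β η (‖slicePoint I p‖ ^ 2) •
        (star (bergmanKernel β η (slicePoint I p) q) * sliceExtension f (slicePoint I p)) := by
  obtain ⟨c, hc, hcirc⟩ := exists_real_coeff_hasSum_and_circle_integral hd hconj
  have hmom := fun k => integral_ball_bergmanWeight_mul_conj_pow hd hC0 hC hβ hη k
  set a : ℕ → ℝ := fun k => Real.Gamma (β + η) / (Real.pi * Real.Gamma η * Real.Gamma β) *
    bergmanCoeff β η k with ha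
  set g : ℕ → ℂ → ℂ := fun k p => (bergmanWeight β η (‖p‖ ^ 2) : ℂ) * (conj p ^ k * f p) with hg
  have hgi : ∀ k, Integrable (g k) (volume.restrict (Metric.ball (0 : ℂ) 1)) := fun k => (hmom k).1
  set L := slicePointCLM hI with hL
  -- `q` and `p` need not commute. Conjugation puts `qᵏ` on the left, so the factor depending on `p`
  -- is the image of a complex function under the real-linear map `L`, which commutes with the
  -- integral.
  set F : ℕ → ℂ → ℍ := fun k p => a k • (q ^ k * L (g k p)) with hF
  have hFi : ∀ k, Integrable (F k) (volume.restrict (Metric.ball (0 : ℂ) 1)) := fun k =>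
    ((L.integrable_comp (hgi k)).const_mul (q ^ k)).smul (a k)
  have hFval : ∀ k, ∫ p in Metric.ball (0 : ℂ) 1, F k p = c k • q ^ k := by
    intro k
    simp only [hF]
    rw [integral_smul, integral_const_mul_of_integrable (L.integrable_comp (hgi k)),
      L.integral_comp_comm (hgi k), (hmom k).2 (c k) (hcirc k), hL, slicePointCLM_apply,
      slicePoint_ofReal, Quaternion.mul_coe_eq_smul, smul_smul]
    congr 1
    have := bergmanCoeff_mul_gamma hβ hη k
    simp only [ha]
    linear_combination (c k) * this
  have hsum : Summable fun k => ∫ p in Metric.ball (0 : ℂ) 1, ‖F k p‖ := by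
    set M : ℝ := ∫ p in Metric.ball (0 : ℂ) 1, ‖g 0 p‖ with hM
    set K : ℝ := Real.Gamma (β + η) / (Real.pi * Real.Gamma η * Real.Gamma β) with hK
    refine Summable.of_nonneg_of_le (fun k => integral_nonneg fun p => norm_nonneg _) (fun k => ?_)
      ((summable_bergmanCoeff_mul_pow hβ hη (norm_nonneg q) hq).mul_left (|K| * M))
    -- As `|p|ᵏ ≤ 1`, integrability of the term `k = 0` controls all terms, and `|q| < 1` makes the
    -- norms summable.
    have h1 : ∀ p ∈ Metric.ball (0 : ℂ) 1,
        ‖F k p‖ ≤ |K| * bergmanCoeff β η k * ‖q‖ ^ k * ‖g 0 p‖ := by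
      intro p hp
      have hp1 : ‖p‖ < 1 := by simpa using hp
      have hb := (bergmanCoeff_pos hβ hη k).le
      have hpk : ‖p‖ ^ k ≤ 1 := pow_le_one₀ (norm_nonneg p) hp1.le
      simp only [hF, hL, slicePointCLM_apply, norm_smul, norm_mul, norm_slicePoint hI, norm_pow,
        hg, RCLike.norm_conj, ha, pow_zero, one_mul, Real.norm_eq_abs, abs_of_nonneg hb,
        Complex.norm_real]
      calc |K| * bergmanCoeff β η k * (‖q‖ ^ k * (|bergmanWeight β η (‖p‖ ^ 2)| *
            (‖p‖ ^ k * ‖f p‖)))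
          ≤ |K| * bergmanCoeff β η k * (‖q‖ ^ k * (|bergmanWeight β η (‖p‖ ^ 2)| *
            (1 * ‖f p‖))) := by gcongr
        _ = _ := by ring
    refine (setIntegral_mono_on (hFi k).norm ((hgi 0).norm.const_mul _)
      Metric.isOpen_ball.measurableSet h1).trans (le_of_eq ?_)
    rw [integral_const_mul]
    ring
  have key := integrable_and_hasSum_integral hFi hsum
    (f := fun p : ℂ => bergmanWeight β η (‖slicePoint I p‖ ^ 2) •
        (star (bergmanKernel β η (slicePoint I p) q) * sliceExtension f (slicePoint I p))) ?_
  · refine ⟨key.1, ?_⟩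
    obtain ⟨J, z, hJ, hz, hJz⟩ := exists_slicePoint_eq q
    have hz1 : ‖z‖ < 1 := by rwa [hz]
    have h2 := key.2
    simp only [hFval] at h2
    have h3 := (hc z hz1).mapL (slicePointCLM hJ)
    have h4 : HasSum (fun k => c k • q ^ k) (sliceExtension f q) := by
      rw [← hJz, sliceExtension_slicePoint (hconj z hz1) hJ, ← slicePointCLM_apply hJ (f z)]
      refine h3.congr_terms fun k => ?_
      rw [slicePointCLM_apply, slicePoint_mul hJ, slicePoint_pow hJ, slicePoint_ofReal,
        Quaternion.coe_mul_eq_smul]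
    exact h4.unique h2
  · refine (ae_restrict_iff' Metric.isOpen_ball.measurableSet).2
      (Filter.Eventually.of_forall fun p hp => ?_)
    have hp1 : ‖p‖ < 1 := by simpa using hp
    have h := ((hasSum_bergmanKernel hβ hη (p := slicePoint I p) (by rwa [norm_slicePoint hI])
      hq).mul_right (sliceExtension f (slicePoint I p))).const_smul
        (bergmanWeight β η (‖slicePoint I p‖ ^ 2))
    refine h.congr_terms fun k => ?_
    rw [sliceExtension_slicePoint (hconj p hp1) hI, norm_slicePoint hI, star_slicePoint hI]
    simp only [hF, hL, slicePointCLM_apply, hg, slicePoint_mul hI, slicePoint_pow hI,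
      slicePoint_ofReal, Quaternion.coe_mul_eq_smul, ha]
    rw [mul_smul_comm, smul_mul_assoc, smul_comm, mul_assoc (q ^ k)]

theorem differentiableOn_hilleHardyComplex {α : ℝ} (hα : -1 < α) {x y : ℝ} (hx : 0 < x)
    (hy : 0 < y) : DifferentiableOn ℂ (hilleHardyComplex α x y) (Metric.ball 0 1) := by
  refine DifferentiableOn.congr (f := fun z : ℂ =>
    (1 - z) ^ (-((α + 1 : ℝ) : ℂ)) * Complex.exp (-(z * (x + y)) / (1 - z)) *
        besselSeries α (z * x * y / (1 - z) ^ 2)) ?_ fun z hz =>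
    hilleHardyComplex_eq_besselSeries α hx hy (by simpa using hz)
  intro z hz
  have hz1 : ‖z‖ < 1 := by simpa using hz
  have h1z := one_sub_ne_zero hz1
  have hid : DifferentiableAt ℂ (fun z : ℂ => 1 - z) z := by fun_prop
  have d1 : DifferentiableAt ℂ (fun z : ℂ => (1 - z) ^ (-((α + 1 : ℝ) : ℂ))) z :=
    hid.cpow_const (Or.inl (one_sub_re_pos hz1))
  have d2 : DifferentiableAt ℂ (fun z : ℂ => Complex.exp (-(z * (x + y)) / (1 - z))) z :=
    (DifferentiableAt.div (by fun_prop) hid h1z).cexp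
  have d3 : DifferentiableAt ℂ (fun z : ℂ => besselSeries α (z * x * y / (1 - z) ^ 2)) z :=
    (differentiable_besselSeries hα _).comp z
      (DifferentiableAt.div (by fun_prop) (hid.pow 2) (pow_ne_zero 2 h1z))
  exact ((d1.mul d2).mul d3).differentiableWithinAt

theorem mainTheorem8 (α : ℝ) (hα : -1 < α) (y : ℝ) (hy : 0 < y) (q : ℍ) (hq : ‖q‖ < 1) :
    (∀ (β η : ℝ), 0 < β → 0 < η → ∀ I : ℍ, I * I = -1 → ∀ x : ℝ, 0 < x →
      IntegrableOn (fun p : ℂ =>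
        bergmanWeight β η (‖slicePoint I p‖ ^ 2) •
          (star (bergmanKernel β η (slicePoint I p) q) *
            hilleHardyKernel α (slicePoint I p) x y))
        (Metric.ball (0 : ℂ) 1) ∧
      hilleHardyKernel α q x y =
        ∫ p in Metric.ball (0 : ℂ) 1,
          bergmanWeight β η (‖slicePoint I p‖ ^ 2) •
            (star (bergmanKernel β η (slicePoint I p) q) *
              hilleHardyKernel α (slicePoint I p) x y)) ∧
    (IntegrableOn
        (fun x : ℝ => ‖hilleHardyKernel α q x y‖ ^ 2 * (x ^ α * Real.exp (-x)))
        (Set.Ioi 0) ∧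
      hilleHardyKernel α ((‖q‖ ^ 2 : ℝ) : ℍ) y y =
        ((∫ x in Set.Ioi (0 : ℝ),
          ‖hilleHardyKernel α q x y‖ ^ 2 * (x ^ α * Real.exp (-x)) : ℝ) : ℍ)) := by
  constructor
  · intro β η hβ hη I hI x hx
    obtain ⟨C, hC0, hC⟩ := exists_norm_hilleHardyComplex_le hα hx hy
    exact integral_star_bergmanKernel_mul_sliceExtension
      (differentiableOn_hilleHardyComplex hα hx hy)
      (fun z hz => hilleHardyComplex_conj α hx hy hz) hC0 hC hβ hη hI hq
  · obtain ⟨J, z, hJ, hz, hJz⟩ := exists_slicePoint_eq q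
    have hz1 : ‖z‖ < 1 := by rwa [hz]
    obtain ⟨hint, hval⟩ := integral_norm_hilleHardyComplex_sq hα hy hz1
    have hpt : ∀ x ∈ Set.Ioi (0 : ℝ), ‖hilleHardyComplex α x y z‖ ^ 2 * (x ^ α * Real.exp (-x)) =
        ‖hilleHardyKernel α q x y‖ ^ 2 * (x ^ α * Real.exp (-x)) := by
      intro x hx
      rw [← hJz, hilleHardyKernel_slicePoint α hx hy hz1 hJ, norm_slicePoint hJ]
    refine ⟨(integrableOn_congr_fun hpt measurableSet_Ioi).1 hint, ?_⟩
    have hzz : ‖((‖q‖ ^ 2 : ℝ) : ℂ)‖ < 1 := by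
      rw [Complex.norm_real, Real.norm_of_nonneg (by positivity)]
      nlinarith [norm_nonneg q]
    rw [← slicePoint_ofReal J, hilleHardyKernel_slicePoint α hy hy hzz hJ, ← hz, hval,
      slicePoint_ofReal, setIntegral_congr_fun measurableSet_Ioi hpt]
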